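/- Let $\Delta$ be a triangulation of a region in the plane, i.e. a finite straight-line simplicial complex in $\mathbb{R}^2$ whose union is the closure of a nonempty connected open set. Let $G_\Delta$ be its dual graph, considered as a plane graph: it has one vertex for each triangle of $\Delta$ (drawn at its barycentre), and an edge between two vertices whenever the two triangles share an edge of $\Delta$ (drawn as a polygonal arc through the midpoint of the shared edge). Let $e$ be the number of edges of $G_\Delta$ and let $f$ be the number of its bounded faces, i.e. of the bounded connected components of the complement of $G_\Delta$ in the plane. Suppose that $G_\Delta$ is contractible, meaning that $e-3f\leqslant 0$. Then $\Delta$ is a subdivided triangle: there are three affinely independent points $a,b,c$ such that the boundary edges of $\Delta$ (the edges lying on exactly one triangle of $\Delta$) are precisely $ab$, $bc$, $ca$, and the union of $\Delta$ is the triangle with vertices $a,b,c$. -/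

import Mathlib

namespace PlanarTriangulation

open Geometry

/-- The Euclidean plane. -/
abbrev Plane : Type := EuclideanSpace ℝ (Fin 2)

/-- `Δ` is a (finite, straight-line) triangulation of the compact plane region `closure Ω`, where
`Ω` is a nonempty connected open subset of the plane. -/
structure IsTriangulationOf (Δ : SimplicialComplex ℝ Plane) (Ω : Set Plane) : Prop where
  isOpen : IsOpen Ω
  isConnected : IsConnected Ω
  finite_faces : Δ.faces.Finite
  space_eq : Δ.space = closure Ω

/-- The triangles of `Δ`. -/
def triangles (Δ : SimplicialComplex ℝ Plane) : Set (Finset Plane) :=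
  {t | t ∈ Δ.faces ∧ t.card = 3}

/-- The edges of `Δ`. -/
def edges (Δ : SimplicialComplex ℝ Plane) : Set (Finset Plane) :=
  {e | e ∈ Δ.faces ∧ e.card = 2}

/-- The boundary edges of `Δ`: the edges that lie on exactly one triangle. -/
def boundaryEdges (Δ : SimplicialComplex ℝ Plane) : Set (Finset Plane) :=
  {e | e ∈ edges Δ ∧ ∃! t, t ∈ triangles Δ ∧ e ⊆ t}

/-- The dual graph `G_Δ`: one vertex for every triangle of `Δ`, two vertices being joined when the
triangles share an edge of `Δ`. (Two distinct triangles share at most one edge, so that this is a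
simple graph.) -/
def dualGraph (Δ : SimplicialComplex ℝ Plane) : SimpleGraph (triangles Δ) where
  Adj s t := s ≠ t ∧ ∃ e ∈ edges Δ, e ⊆ s.1 ∧ e ⊆ t.1
  symm := ⟨fun _ _ h => ⟨h.1.symm, h.2.imp fun _ he => ⟨he.1, he.2.2, he.2.1⟩⟩⟩
  loopless := ⟨fun _ h => h.1 rfl⟩

/-- The barycentre of a simplex; for an edge this is its midpoint. -/
noncomputable def barycenter (s : Finset Plane) : Plane :=
  (s.card : ℝ)⁻¹ • ∑ x ∈ s, x

/-- The dual graph as a plane graph, that is, the subset of the plane which is its drawing: the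
vertex dual to a triangle is the barycentre of the triangle, and the edge between the triangles `s`
and `t` that share the edge `e` is the polygonal arc from the barycentre of `s` through the
midpoint of `e` to the barycentre of `t`. -/
def dualDrawing (Δ : SimplicialComplex ℝ Plane) : Set Plane :=
  {p | ∃ t ∈ triangles Δ, p = barycenter t} ∪
  {p | ∃ s ∈ triangles Δ, ∃ t ∈ triangles Δ, ∃ e ∈ edges Δ, s ≠ t ∧ e ⊆ s ∧ e ⊆ t ∧
    p ∈ segment ℝ (barycenter s) (barycenter e) ∪ segment ℝ (barycenter e) (barycenter t)}

/-- The bounded faces of the plane graph `G_Δ`: the bounded connected components of the complement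
of its drawing. -/
def dualBoundedFaces (Δ : SimplicialComplex ℝ Plane) : Set (Set Plane) :=
  {F | Bornology.IsBounded F ∧
    ∃ p ∈ (dualDrawing Δ)ᶜ, F = connectedComponentIn (dualDrawing Δ)ᶜ p}

/-- `G_Δ` is contractible: `e - 3 f ≤ 0`, where `e` is the number of its edges and `f` the number
of its bounded faces. -/
def DualContractible (Δ : SimplicialComplex ℝ Plane) : Prop :=
  ((dualGraph Δ).edgeSet.ncard : ℤ) - 3 * ((dualBoundedFaces Δ).ncard : ℤ) ≤ 0

/-- `Δ` is a subdivided triangle: its boundary is a triangle `abc` (the boundary edges are exactly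
the three edges `ab`, `bc`, `ca`), and `Δ` subdivides this triangle. -/
def IsSubdividedTriangle (Δ : SimplicialComplex ℝ Plane) : Prop :=
  ∃ a b c : Plane, AffineIndependent ℝ ![a, b, c] ∧
    (∀ e : Finset Plane, e ∈ boundaryEdges Δ ↔
      (e : Set Plane) = {a, b} ∨ (e : Set Plane) = {b, c} ∨ (e : Set Plane) = {c, a}) ∧
    Δ.space = convexHull ℝ {a, b, c}

end PlanarTriangulation

/-!
Let `T`, `B`, `I` be the numbers of triangles, boundary edges and inner edges of `Δ`, and let the
dual graph have `e` edges and `f` bounded faces.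

* Counting the sides of the triangles gives `3 T = B + 2 I`, and `I ≤ e`.
* The easy half of Euler's formula, `f + T ≤ I + 1`, is linear algebra over `ZMod 2`. The incidence
  map from functions on the inner edges to functions on the triangles has rank at least `T - 1`,
  because the dual graph is connected. Its kernel contains the coboundaries of the functions on the
  bounded faces, and these form a space of dimension `f`: every face contains a vertex of `Δ`, and a
  function without coboundary is constant along the edges of `Δ`, hence zero, since some vertex lies
  in an unbounded face.

Hence `B + 3 f ≤ e + 3`, and contractibility gives `B ≤ 3`. Counting sides at a single vertex shows
that each vertex lies on an even number of boundary edges, so these form a triangle. The frontier of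
`Δ.space` lies on the boundary edges. Hence a connected set which avoids these edges and meets
`Δ.space` lies in it. For the open triangle this shows that it is covered by `Δ`; for a half-plane
it is impossible, so nothing of `Δ` can lie outside the triangle.
-/

namespace PlanarTriangulation

open Geometry Set Filter Topology

section Combinatorics

variable {α : Type*}

theorem sum_powersetCard_succ_sum {M : Type*} [AddCommMonoid M] (t : Finset α) (k : ℕ)
    (φ : α → M) :
    ∑ s ∈ t.powersetCard (k + 1), ∑ x ∈ s, φ x = (t.card - 1).choose k • ∑ x ∈ t, φ x := by
  classical
  calc ∑ s ∈ t.powersetCard (k + 1), ∑ x ∈ s, φ x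
      = ∑ x ∈ t, ∑ _s ∈ t.powersetCard (k + 1) with x ∈ _s, φ x :=
        Finset.sum_comm' fun s x => by
          simp only [Finset.mem_powersetCard, Finset.mem_filter]
          exact ⟨fun h => ⟨h, h.1.1 h.2⟩, fun h => h.1⟩
    _ = ∑ x ∈ t, (t.card - 1).choose k • φ x := by
        refine Finset.sum_congr rfl fun x hx => ?_
        have hcard := Finset.card_filter_powersetCard_subset {x} t (k + 1)
          (Finset.singleton_subset_iff.2 hx) (by simp)
        simp only [Finset.singleton_subset_iff, Finset.card_singleton,
          Nat.add_sub_cancel] at hcard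
        rw [Finset.sum_const, hcard]
    _ = (t.card - 1).choose k • ∑ x ∈ t, φ x := (Finset.smul_sum).symm

theorem exists_ne_mem_of_even_card {S : Finset α} (hS : Even S.card) {e : α} (he : e ∈ S) :
    ∃ e' ∈ S, e' ≠ e := by
  refine S.exists_mem_ne ?_ e
  have := Finset.card_pos.2 ⟨e, he⟩
  obtain ⟨k, hk⟩ := hS
  omega

theorem exists_triangle_of_even_degrees [DecidableEq α] {B : Finset (Finset α)}
    (hpair : ∀ e ∈ B, e.card = 2) (heven : ∀ v, Even (B.filter (v ∈ ·)).card)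
    (hne : B.Nonempty) (hcard : B.card ≤ 3) :
    ∃ a b c, a ≠ b ∧ b ≠ c ∧ c ≠ a ∧ B = {{a, b}, {b, c}, {c, a}} := by
  have pair_eq_pair : ∀ x y u v : α,
      ({x, y} : Finset α) = {u, v} ↔ x = u ∧ y = v ∨ x = v ∧ y = u := fun x y u v => by
    rw [← Finset.coe_inj, Finset.coe_pair, Finset.coe_pair, pair_eq_pair_iff]
  have exists_other : ∀ u v, {u, v} ∈ B → ∃ w, w ≠ u ∧ w ≠ v ∧ {u, w} ∈ B := by
    intro u v huv
    obtain ⟨e, he, hne⟩ := exists_ne_mem_of_even_card (heven u) (e := {u, v}) (by simp [huv])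
    obtain ⟨heB, hue⟩ := Finset.mem_filter.1 he
    obtain ⟨w, hw⟩ := Finset.card_eq_one.1 (by rw [Finset.card_erase_of_mem hue, hpair e heB] :
      (e.erase u).card = 1)
    have he' : e = {u, w} := by rw [← Finset.insert_erase hue, hw]
    have hwu : w ≠ u := Finset.ne_of_mem_erase (hw ▸ Finset.mem_singleton_self w)
    exact ⟨w, hwu, fun h => hne (by rw [he', h]), he' ▸ heB⟩
  obtain ⟨e, he⟩ := hne
  obtain ⟨a, b, hab, rfl⟩ := Finset.card_eq_two.1 (hpair e he)
  obtain ⟨c, hca, hcb, hac⟩ := exists_other a b he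
  obtain ⟨d, hdb, hda, hbd⟩ := exists_other b a (Finset.pair_comm a b ▸ he)
  have hB : {{a, b}, {a, c}, {b, d}} = B := by
    refine Finset.eq_of_subset_of_card_le ?_ (hcard.trans_eq (Eq.symm ?_))
    · simp only [Finset.insert_subset_iff, Finset.singleton_subset_iff, he, hac, hbd, and_self]
    · rw [Finset.card_eq_three]
      refine ⟨_, _, _, ?_, ?_, ?_, rfl⟩ <;> rw [ne_eq, pair_eq_pair] <;> tauto
  obtain ⟨f, -, hfa, hcf⟩ := exists_other c a (Finset.pair_comm a c ▸ hac)
  have hcd : c = d := by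
    simp only [← hB, Finset.mem_insert, Finset.mem_singleton, pair_eq_pair] at hcf
    tauto
  refine ⟨a, b, c, hab, hcb.symm, hca, ?_⟩
  rw [← hB, hcd, Finset.pair_comm d a]
  exact congrArg _ (Finset.pair_comm _ _)

end Combinatorics

section Weights

variable {𝕜 E : Type*} [Field 𝕜] [LinearOrder 𝕜] [AddCommGroup E] [Module 𝕜 E]

/-- `w` is a system of barycentric coordinates of the point `p` with respect to the vertices of the
simplex `s`. The coordinates are functions on the whole space, extended by zero outside `s`, so
that a point of a common face has the same coordinates with respect to both simplices. -/
structure IsBarycentric (s : Finset E) (w : E → 𝕜) (p : E) : Prop where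
  nonneg : ∀ x, 0 ≤ w x
  eq_zero : ∀ x ∉ s, w x = 0
  sum_eq_one : ∑ x ∈ s, w x = 1
  sum_smul : ∑ x ∈ s, w x • x = p

namespace IsBarycentric

variable {s t : Finset E} {w w' : E → 𝕜} {p q : E}

theorem mono (h : IsBarycentric s w p) (hst : s ⊆ t) : IsBarycentric t w p where
  nonneg := h.nonneg
  eq_zero x hx := h.eq_zero x (mt (@hst x) hx)
  sum_eq_one := by
    rw [← h.sum_eq_one]
    exact (Finset.sum_subset hst fun x _ hx => h.eq_zero x hx).symm
  sum_smul := by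
    rw [← h.sum_smul]
    exact (Finset.sum_subset hst fun x _ hx => by rw [h.eq_zero x hx, zero_smul]).symm

theorem restrict (h : IsBarycentric t w p) (hst : s ⊆ t) (h0 : ∀ x ∉ s, w x = 0) :
    IsBarycentric s w p where
  nonneg := h.nonneg
  eq_zero := h0
  sum_eq_one := by
    rw [← h.sum_eq_one]
    exact Finset.sum_subset hst fun x _ hx => h0 x hx
  sum_smul := by
    rw [← h.sum_smul]
    exact Finset.sum_subset hst fun x _ hx => by rw [h0 x hx, zero_smul]

theorem eq_of_affineIndependent (hs : AffineIndependent 𝕜 ((↑) : s → E))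
    (h : IsBarycentric s w p) (h' : IsBarycentric s w' p) : w = w' := by
  have hsum : ∑ x : s, (w x - w' x) = 0 := by
    rw [Finset.sum_sub_distrib, Finset.sum_coe_sort s, Finset.sum_coe_sort s, h.sum_eq_one,
      h'.sum_eq_one, sub_self]
  have hsmul : ∑ x : s, (w x - w' x) • (x : E) = 0 := by
    simp_rw [sub_smul]
    rw [Finset.sum_sub_distrib, Finset.sum_coe_sort s (fun x => w x • x),
      Finset.sum_coe_sort s (fun x => w' x • x), h.sum_smul, h'.sum_smul, sub_self]
  funext x
  by_cases hx : x ∈ s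
  · exact sub_eq_zero.1
      (affineIndependent_iff.1 hs Finset.univ _ hsum hsmul ⟨x, hx⟩ (Finset.mem_univ _))
  · rw [h.eq_zero x hx, h'.eq_zero x hx]

end IsBarycentric

variable [IsStrictOrderedRing 𝕜]

theorem IsBarycentric.mem_convexHull {s : Finset E} {w : E → 𝕜} {p : E}
    (h : IsBarycentric s w p) : p ∈ convexHull 𝕜 (s : Set E) :=
  Finset.mem_convexHull'.2 ⟨w, fun x _ => h.nonneg x, h.sum_eq_one, h.sum_smul⟩

theorem exists_isBarycentric {s : Finset E} {p : E} (hp : p ∈ convexHull 𝕜 (s : Set E)) :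
    ∃ w : E → 𝕜, IsBarycentric s w p := by
  classical
  obtain ⟨w, h0, h1, h2⟩ := Finset.mem_convexHull'.1 hp
  have hw : ∀ x ∈ s, (if x ∈ s then w x else 0) = w x := fun x hx => if_pos hx
  refine ⟨fun x => if x ∈ s then w x else 0, fun x => ?_, fun x hx => if_neg hx, ?_, ?_⟩
  · split_ifs with hx
    exacts [h0 x hx, le_rfl]
  · rw [Finset.sum_congr rfl hw, h1]
  · rw [Finset.sum_congr rfl fun x hx => by rw [hw x hx], h2]

theorem IsBarycentric.eq_of_mem_faces {Δ : SimplicialComplex 𝕜 E} {s t : Finset E}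
    {w w' : E → 𝕜} {p : E} (hs : s ∈ Δ.faces) (ht : t ∈ Δ.faces)
    (h : IsBarycentric s w p) (h' : IsBarycentric t w' p) : w = w' := by
  classical
  have hp := Δ.inter_subset_convexHull hs ht ⟨h.mem_convexHull, h'.mem_convexHull⟩
  rw [← Finset.coe_inter] at hp
  obtain ⟨w'', h''⟩ := exists_isBarycentric hp
  rw [h.eq_of_affineIndependent (Δ.indep hs) (h''.mono Finset.inter_subset_left),
    h'.eq_of_affineIndependent (Δ.indep ht) (h''.mono Finset.inter_subset_right)]

theorem IsBarycentric.combine {s : Finset E} {w w' : E → 𝕜} {p q : E} {a b : 𝕜}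
    (h : IsBarycentric s w p) (h' : IsBarycentric s w' q) (ha : 0 ≤ a)
    (hb : 0 ≤ b) (hab : a + b = 1) :
    IsBarycentric s (fun x => a * w x + b * w' x) (a • p + b • q) where
  nonneg x := add_nonneg (mul_nonneg ha (h.nonneg x)) (mul_nonneg hb (h'.nonneg x))
  eq_zero x hx := by rw [h.eq_zero x hx, h'.eq_zero x hx, mul_zero, mul_zero, add_zero]
  sum_eq_one := by
    rw [Finset.sum_add_distrib, ← Finset.mul_sum, ← Finset.mul_sum, h.sum_eq_one, h'.sum_eq_one,
      mul_one, mul_one, hab]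
  sum_smul := by
    simp_rw [add_smul, mul_smul]
    rw [Finset.sum_add_distrib, ← Finset.smul_sum, ← Finset.smul_sum, h.sum_smul, h'.sum_smul]

theorem isBarycentric_single [DecidableEq E] {s : Finset E} {v : E} (hv : v ∈ s) :
    IsBarycentric s (fun x => if x = v then (1 : 𝕜) else 0) v where
  nonneg x := by split_ifs <;> simp
  eq_zero x hx := if_neg fun h : x = v => hx (h ▸ hv)
  sum_eq_one := by simp [hv]
  sum_smul := by simp [hv]

variable (𝕜) in
/-- The relatively open simplex spanned by `s`: the points with positive barycentric coordinates
with respect to all the vertices in `s`. -/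
def openSimplex (s : Finset E) : Set E :=
  {p | ∃ w : E → 𝕜, IsBarycentric s w p ∧ ∀ x ∈ s, 0 < w x}

theorem openSimplex_subset_convexHull (s : Finset E) :
    openSimplex 𝕜 s ⊆ convexHull 𝕜 (s : Set E) := fun _ ⟨_, hw, _⟩ => hw.mem_convexHull

theorem nonempty_of_mem_openSimplex {s : Finset E} {p : E} (hp : p ∈ openSimplex 𝕜 s) :
    s.Nonempty := by
  rw [← Finset.coe_nonempty, ← convexHull_nonempty_iff (𝕜 := 𝕜)]
  exact ⟨p, openSimplex_subset_convexHull s hp⟩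

theorem exists_subset_mem_openSimplex {t : Finset E} {p : E}
    (hp : p ∈ convexHull 𝕜 (t : Set E)) : ∃ s ⊆ t, p ∈ openSimplex 𝕜 s := by
  obtain ⟨w, hw⟩ := exists_isBarycentric hp
  refine ⟨t.filter fun x => 0 < w x, Finset.filter_subset _ _, w,
    hw.restrict (Finset.filter_subset _ _) fun x hx => ?_, fun x hx => (Finset.mem_filter.1 hx).2⟩
  by_cases hxt : x ∈ t
  · exact le_antisymm (not_lt.1 fun h => hx (Finset.mem_filter.2 ⟨hxt, h⟩)) (hw.nonneg x)
  · exact hw.eq_zero x hxt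

theorem subset_of_mem_openSimplex {Δ : SimplicialComplex 𝕜 E} {s t : Finset E} {p : E}
    (hs : s ∈ Δ.faces) (ht : t ∈ Δ.faces) (hps : p ∈ openSimplex 𝕜 s)
    (hpt : p ∈ convexHull 𝕜 (t : Set E)) : s ⊆ t := by
  obtain ⟨w, hw, hpos⟩ := hps
  obtain ⟨w', hw'⟩ := exists_isBarycentric hpt
  obtain rfl := hw.eq_of_mem_faces hs ht hw'
  intro x hx
  by_contra hxt
  exact (hpos x hx).ne' (hw'.eq_zero x hxt)

theorem disjoint_openSimplex_convexHull {s e : Finset E}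
    (hs : AffineIndependent 𝕜 ((↑) : s → E)) (hes : e ⊂ s) :
    Disjoint (openSimplex 𝕜 s) (convexHull 𝕜 (e : Set E)) := by
  refine disjoint_left.2 fun p ⟨w, hw, hpos⟩ hpe => ?_
  obtain ⟨w', hw'⟩ := exists_isBarycentric hpe
  obtain rfl := hw.eq_of_affineIndependent hs (hw'.mono hes.subset)
  obtain ⟨x, hxs, hxe⟩ := Finset.exists_of_ssubset hes
  exact (hpos x hxs).ne' (hw'.eq_zero x hxe)

end Weights

theorem isBarycentric_barycenter [DecidableEq Plane] {s : Finset Plane} (hs : s.Nonempty) :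
    IsBarycentric s (fun x => if x ∈ s then (s.card : ℝ)⁻¹ else 0) (barycenter s) where
  nonneg x := by split_ifs <;> simp
  eq_zero x hx := if_neg hx
  sum_eq_one := by simp [hs.ne_empty]
  sum_smul := by
    rw [barycenter, Finset.smul_sum]
    exact Finset.sum_congr rfl fun x hx => by rw [if_pos hx]

theorem barycenter_mem_openSimplex {s : Finset Plane} (hs : s.Nonempty) :
    barycenter s ∈ openSimplex ℝ s := by
  classical
  exact ⟨_, isBarycentric_barycenter hs, fun x hx => by simp [hx, hs]⟩

section TopDimensional

variable {E : Type*} [NormedAddCommGroup E] [NormedSpace ℝ E] [FiniteDimensional ℝ E]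
  {Δ : SimplicialComplex ℝ E} {s t e : Finset E} {p : E}

/-- The vertices of a simplex of full dimension, as an affine basis of the space. -/
def affineBasisOfCard (hs : AffineIndependent ℝ ((↑) : s → E))
    (hcard : s.card = Module.finrank ℝ E + 1) : AffineBasis s ℝ E where
  toFun := (↑)
  ind' := hs
  tot' := hs.affineSpan_eq_top_iff_card_eq_finrank_add_one.2 (by rw [Fintype.card_coe, hcard])

@[simp]
theorem affineBasisOfCard_apply (hs : AffineIndependent ℝ ((↑) : s → E))
    (hcard : s.card = Module.finrank ℝ E + 1) (x : s) : affineBasisOfCard hs hcard x = x := rfl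

theorem range_affineBasisOfCard (hs : AffineIndependent ℝ ((↑) : s → E))
    (hcard : s.card = Module.finrank ℝ E + 1) : range (affineBasisOfCard hs hcard) = s :=
  Subtype.range_coe

theorem IsBarycentric.coord_eq {w : E → ℝ} (h : IsBarycentric s w p)
    (hs : AffineIndependent ℝ ((↑) : s → E)) (hcard : s.card = Module.finrank ℝ E + 1) (x : s) :
    (affineBasisOfCard hs hcard).coord x p = w x := by
  have hsum : ∑ y : s, w y = 1 := (Finset.sum_coe_sort s w).trans h.sum_eq_one
  have hp : Finset.univ.affineCombination ℝ (affineBasisOfCard hs hcard) (fun y : s => w y) =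
      p := by
    rw [Finset.univ.affineCombination_eq_linear_combination _ _ hsum, ← h.sum_smul]
    exact Finset.sum_coe_sort s fun y => w y • y
  rw [← hp]
  exact (affineBasisOfCard hs hcard).coord_apply_combination_of_mem (Finset.mem_univ x) hsum

theorem coord_vertex [DecidableEq E] (hs : AffineIndependent ℝ ((↑) : s → E))
    (hcard : s.card = Module.finrank ℝ E + 1) {y : E} (hy : y ∈ s) (x : s) :
    (affineBasisOfCard hs hcard).coord x y = if (x : E) = y then 1 else 0 :=
  (isBarycentric_single hy).coord_eq hs hcard x

theorem mem_convexHull_iff_coord (hs : AffineIndependent ℝ ((↑) : s → E))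
    (hcard : s.card = Module.finrank ℝ E + 1) :
    p ∈ convexHull ℝ (s : Set E) ↔ ∀ x, 0 ≤ (affineBasisOfCard hs hcard).coord x p := by
  rw [← range_affineBasisOfCard hs hcard, AffineBasis.convexHull_eq_nonneg_coord, mem_ofPred_eq]

theorem mem_openSimplex_iff_coord (hs : AffineIndependent ℝ ((↑) : s → E))
    (hcard : s.card = Module.finrank ℝ E + 1) :
    p ∈ openSimplex ℝ s ↔ ∀ x, 0 < (affineBasisOfCard hs hcard).coord x p := by
  constructor
  · rintro ⟨w, hw, hpos⟩ x
    exact (hw.coord_eq hs hcard x).symm ▸ hpos x x.2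
  · intro hpos
    obtain ⟨w, hw⟩ := exists_isBarycentric
      ((mem_convexHull_iff_coord hs hcard).2 fun x => (hpos x).le)
    exact ⟨w, hw, fun x hx => hw.coord_eq hs hcard ⟨x, hx⟩ ▸ hpos ⟨x, hx⟩⟩

theorem interior_convexHull_eq_openSimplex (hs : AffineIndependent ℝ ((↑) : s → E))
    (hcard : s.card = Module.finrank ℝ E + 1) :
    interior (convexHull ℝ (s : Set E)) = openSimplex ℝ s := by
  ext p
  rw [mem_openSimplex_iff_coord hs hcard, ← range_affineBasisOfCard hs hcard,
    AffineBasis.interior_convexHull, mem_ofPred_eq]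

theorem interior_convexHull_eq_empty (hs : AffineIndependent ℝ ((↑) : s → E))
    (hcard : s.card ≠ Module.finrank ℝ E + 1) : interior (convexHull ℝ (s : Set E)) = ∅ := by
  by_contra hne
  have htop := interior_convexHull_nonempty_iff_affineSpan_eq_top.1 (nonempty_iff_ne_empty.2 hne)
  rw [← Subtype.range_coe (s := (s : Set E))] at htop
  exact hcard (by
    simpa using hs.affineSpan_eq_top_iff_card_eq_finrank_add_one.1 htop)

section Facet

variable [DecidableEq E] {c d : E} {ℓ : E →ᵃ[ℝ] ℝ}

theorem eq_coord_mul_of_vanishing (hind : AffineIndependent ℝ ((↑) : ↥(insert c e) → E))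
    (hcard : (insert c e).card = Module.finrank ℝ E + 1) (hℓ : ∀ x ∈ e, ℓ x = 0) (x : E) :
    ℓ x = (affineBasisOfCard hind hcard).coord ⟨c, Finset.mem_insert_self c e⟩ x * ℓ c := by
  set b := affineBasisOfCard hind hcard
  have hℓ_eq : ℓ = (LinearMap.mulRight ℝ (ℓ c)).toAffineMap.comp
      (b.coord ⟨c, Finset.mem_insert_self c e⟩) := by
    refine AffineMap.ext_on b.tot ?_
    rintro _ ⟨⟨y, hy⟩, rfl⟩
    obtain rfl | hye := Finset.mem_insert.1 hy
    · simp [b, coord_vertex]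
    · by_cases hyc : y = c
      · simp [b, coord_vertex, hyc]
      · simp [b, coord_vertex hind hcard hy, hℓ y hye, Ne.symm hyc]
  exact DFunLike.congr_fun hℓ_eq x

theorem apply_apex_ne_zero (hind : AffineIndependent ℝ ((↑) : ↥(insert c e) → E))
    (hcard : (insert c e).card = Module.finrank ℝ E + 1) (hℓ : ∀ x ∈ e, ℓ x = 0)
    (hne : ∃ x, ℓ x ≠ 0) : ℓ c ≠ 0 := by
  obtain ⟨x, hx⟩ := hne
  rw [eq_coord_mul_of_vanishing hind hcard hℓ] at hx
  exact right_ne_zero_of_mul hx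

theorem exists_affineMap_vanishing (hind : AffineIndependent ℝ ((↑) : ↥(insert c e) → E))
    (hcard : (insert c e).card = Module.finrank ℝ E + 1) (hc : c ∉ e) :
    ∃ ℓ : E →ᵃ[ℝ] ℝ, (∀ x ∈ e, ℓ x = 0) ∧ ℓ c ≠ 0 := by
  refine ⟨(affineBasisOfCard hind hcard).coord ⟨c, Finset.mem_insert_self c e⟩,
    fun x hx => ?_, ?_⟩
  · rw [coord_vertex hind hcard (Finset.mem_insert_of_mem hx), if_neg]
    rintro rfl
    exact hc hx
  · rw [coord_vertex hind hcard (Finset.mem_insert_self c e), if_pos rfl]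
    exact one_ne_zero

theorem eventually_coord_pos (hind : AffineIndependent ℝ ((↑) : ↥(insert c e) → E))
    (hcard : (insert c e).card = Module.finrank ℝ E + 1) (hp : p ∈ openSimplex ℝ e) :
    ∀ᶠ q in 𝓝 p, ∀ x : ↥(insert c e), ↑x ∈ e → 0 < (affineBasisOfCard hind hcard).coord x q := by
  obtain ⟨w, hw, hpos⟩ := hp
  refine eventually_all.2 fun x => ?_
  by_cases hx : ↑x ∈ e
  · have hxp : 0 < (affineBasisOfCard hind hcard).coord x p := by
      rw [(hw.mono (Finset.subset_insert c e)).coord_eq]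
      exact hpos x hx
    filter_upwards [(continuous_barycentric_coord _ x).continuousAt.eventually
      (lt_mem_nhds hxp)] with q hq _ using hq
  · exact Eventually.of_forall fun q h => absurd h hx

theorem eventually_mem_convexHull_insert
    (hind : AffineIndependent ℝ ((↑) : ↥(insert c e) → E))
    (hcard : (insert c e).card = Module.finrank ℝ E + 1) (hℓ : ∀ x ∈ e, ℓ x = 0) (hc : ℓ c ≠ 0)
    (hp : p ∈ openSimplex ℝ e) :
    ∀ᶠ q in 𝓝 p, 0 ≤ ℓ q * ℓ c → q ∈ convexHull ℝ (↑(insert c e) : Set E) := by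
  filter_upwards [eventually_coord_pos hind hcard hp] with q hq hside
  refine (mem_convexHull_iff_coord hind hcard).2 fun x => ?_
  obtain hx | hx := Finset.mem_insert.1 x.2
  · obtain rfl : x = ⟨c, Finset.mem_insert_self c e⟩ := Subtype.ext hx
    rw [eq_coord_mul_of_vanishing hind hcard hℓ, mul_assoc] at hside
    exact nonneg_of_mul_nonneg_left hside (mul_self_pos.2 hc)
  · exact (hq x hx).le

theorem eventually_mem_openSimplex_insert
    (hind : AffineIndependent ℝ ((↑) : ↥(insert c e) → E))
    (hcard : (insert c e).card = Module.finrank ℝ E + 1) (hℓ : ∀ x ∈ e, ℓ x = 0)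
    (hp : p ∈ openSimplex ℝ e) :
    ∀ᶠ q in 𝓝 p, 0 < ℓ q * ℓ c → q ∈ openSimplex ℝ (insert c e) := by
  filter_upwards [eventually_coord_pos hind hcard hp] with q hq hside
  refine (mem_openSimplex_iff_coord hind hcard).2 fun x => ?_
  obtain hx | hx := Finset.mem_insert.1 x.2
  · obtain rfl : x = ⟨c, Finset.mem_insert_self c e⟩ := Subtype.ext hx
    rw [eq_coord_mul_of_vanishing hind hcard hℓ, mul_assoc] at hside
    exact pos_of_mul_pos_left hside (mul_self_nonneg _)
  · exact hq x hx

theorem apex_mul_apex_neg (hc : insert c e ∈ Δ.faces) (hd : insert d e ∈ Δ.faces)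
    (hcard : e.card = Module.finrank ℝ E) (hce : c ∉ e) (hde : d ∉ e) (hcd : c ≠ d)
    (hℓ : ∀ x ∈ e, ℓ x = 0) (hℓc : ℓ c ≠ 0) (hp : p ∈ openSimplex ℝ e) : ℓ c * ℓ d < 0 := by
  have hcard_c : (insert c e).card = Module.finrank ℝ E + 1 := by
    rw [Finset.card_insert_of_notMem hce, hcard]
  have hcard_d : (insert d e).card = Module.finrank ℝ E + 1 := by
    rw [Finset.card_insert_of_notMem hde, hcard]
  have hℓd : ℓ d ≠ 0 := apply_apex_ne_zero (Δ.indep hd) hcard_d hℓ ⟨c, hℓc⟩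
  by_contra! hnonneg
  have hlim : Tendsto (fun r : ℝ => AffineMap.lineMap p c r) (𝓝[>] 0) (𝓝 p) := by
    have hcont : Continuous (fun r : ℝ => AffineMap.lineMap p c r) :=
      AffineMap.lineMap_continuous
    simpa using (hcont.tendsto 0).mono_left (nhdsWithin_le_nhds (s := Ioi 0))
  obtain ⟨r, hrc, hrd, hr⟩ :=
    ((hlim.eventually (eventually_mem_openSimplex_insert (Δ.indep hc) hcard_c hℓ hp)).and
      ((hlim.eventually (eventually_mem_convexHull_insert (Δ.indep hd) hcard_d hℓ hℓd hp)).and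
        self_mem_nhdsWithin)).exists
  have hr : 0 < r := hr
  have hℓp : ℓ p = 0 := by
    obtain ⟨w, hw, -⟩ := hp
    rw [eq_coord_mul_of_vanishing (Δ.indep hc) hcard_c hℓ,
      (hw.mono (Finset.subset_insert c e)).coord_eq, hw.eq_zero c hce, zero_mul]
  have hℓr : ℓ (AffineMap.lineMap p c r) = r * ℓ c := by
    rw [ℓ.apply_lineMap, hℓp, AffineMap.lineMap_apply_module, smul_zero, zero_add, smul_eq_mul]
  rw [hℓr, mul_assoc] at hrc hrd
  have hsub := subset_of_mem_openSimplex hc hd (hrc (mul_pos hr (mul_self_pos.2 hℓc)))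
    (hrd (mul_nonneg hr.le hnonneg))
  obtain h | h := Finset.mem_insert.1 (hsub (Finset.mem_insert_self c e))
  exacts [hcd h, hce h]

end Facet

theorem eq_or_eq_or_eq_of_facet_subset {t₁ t₂ t₃ : Finset E} (he : (openSimplex ℝ e).Nonempty)
    (hcard : e.card = Module.finrank ℝ E) (h₁ : t₁ ∈ Δ.faces) (h₂ : t₂ ∈ Δ.faces)
    (h₃ : t₃ ∈ Δ.faces) (hcard₁ : t₁.card = Module.finrank ℝ E + 1)
    (hcard₂ : t₂.card = Module.finrank ℝ E + 1) (hcard₃ : t₃.card = Module.finrank ℝ E + 1)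
    (he₁ : e ⊆ t₁) (he₂ : e ⊆ t₂) (he₃ : e ⊆ t₃) : t₁ = t₂ ∨ t₁ = t₃ ∨ t₂ = t₃ := by
  classical
  obtain ⟨p, hp⟩ := he
  obtain ⟨a, ha, rfl⟩ := Finset.exists_eq_insert_iff.2 ⟨he₁, by rw [hcard, hcard₁]⟩
  obtain ⟨b, hb, rfl⟩ := Finset.exists_eq_insert_iff.2 ⟨he₂, by rw [hcard, hcard₂]⟩
  obtain ⟨c, hc, rfl⟩ := Finset.exists_eq_insert_iff.2 ⟨he₃, by rw [hcard, hcard₃]⟩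
  obtain ⟨ℓ, hℓ, hℓa⟩ := exists_affineMap_vanishing (Δ.indep h₁) hcard₁ ha
  have hℓb : ℓ b ≠ 0 := apply_apex_ne_zero (Δ.indep h₂) hcard₂ hℓ ⟨a, hℓa⟩
  by_contra! hne
  have hab := apex_mul_apex_neg h₁ h₂ hcard ha hb (fun h => hne.1 (by rw [h])) hℓ hℓa hp
  have hac := apex_mul_apex_neg h₁ h₃ hcard ha hc (fun h => hne.2.1 (by rw [h])) hℓ hℓa hp
  have hbc := apex_mul_apex_neg h₂ h₃ hcard hb hc (fun h => hne.2.2 (by rw [h])) hℓ hℓb hp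
  have hsq := mul_neg_of_pos_of_neg (mul_pos_of_neg_of_neg hab hac) hbc
  nlinarith [sq_nonneg (ℓ a * ℓ b * ℓ c)]

theorem mem_interior_space_of_facet (hs : s ∈ Δ.faces) (ht : t ∈ Δ.faces) (hst : s ≠ t)
    (hcard_s : s.card = Module.finrank ℝ E + 1) (hcard_t : t.card = Module.finrank ℝ E + 1)
    (hcard : e.card = Module.finrank ℝ E) (hes : e ⊆ s) (het : e ⊆ t) (hp : p ∈ openSimplex ℝ e) :
    p ∈ interior Δ.space := by
  classical
  obtain ⟨c, hc, rfl⟩ := Finset.exists_eq_insert_iff.2 ⟨hes, by rw [hcard, hcard_s]⟩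
  obtain ⟨d, hd, rfl⟩ := Finset.exists_eq_insert_iff.2 ⟨het, by rw [hcard, hcard_t]⟩
  obtain ⟨ℓ, hℓ, hℓc⟩ := exists_affineMap_vanishing (Δ.indep hs) hcard_s hc
  have hℓd : ℓ d ≠ 0 := apply_apex_ne_zero (Δ.indep ht) hcard_t hℓ ⟨c, hℓc⟩
  have hneg := apex_mul_apex_neg hs ht hcard hc hd (fun h => hst (by rw [h])) hℓ hℓc hp
  rw [mem_interior_iff_mem_nhds]
  filter_upwards [eventually_mem_convexHull_insert (Δ.indep hs) hcard_s hℓ hℓc hp,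
    eventually_mem_convexHull_insert (Δ.indep ht) hcard_t hℓ hℓd hp] with q hqc hqd
  obtain hq | hq := le_total 0 (ℓ q * ℓ c)
  · exact SimplicialComplex.convexHull_subset_space hs (hqc hq)
  · refine SimplicialComplex.convexHull_subset_space ht (hqd ?_)
    have hprod : 0 ≤ (ℓ q * ℓ d) * (ℓ c * ℓ c) := by
      calc 0 ≤ (ℓ q * ℓ c) * (ℓ c * ℓ d) := mul_nonneg_of_nonpos_of_nonpos hq hneg.le
        _ = (ℓ q * ℓ d) * (ℓ c * ℓ c) := by ring
    exact nonneg_of_mul_nonneg_left hprod (mul_self_pos.2 hℓc)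

end TopDimensional

section Connectedness

theorem forall_of_forall_adj_imp {V : Type*} {G : SimpleGraph V} (hG : G.Preconnected)
    {P : V → Prop} (hP : ∀ u v, G.Adj u v → P u → P v) {u : V} (hu : P u) (v : V) : P v := by
  obtain ⟨walk⟩ := hG u v
  induction walk with
  | nil => exact hu
  | cons hadj _ ih => exact ih (hP _ _ hadj hu)

theorem preconnected_of_closed_cover {X ι : Type*} [TopologicalSpace X] [Finite ι] {C : Set X}
    (hC : IsPreconnected C) {K : ι → Set X} (hK : ∀ i, IsClosed (K i)) (hcover : C ⊆ ⋃ i, K i)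
    (hmeet : ∀ i, (C ∩ K i).Nonempty) {G : SimpleGraph ι}
    (hG : ∀ i j, i ≠ j → (C ∩ (K i ∩ K j)).Nonempty → G.Adj i j) : G.Preconnected := by
  intro i j
  by_contra hij
  have hclosed : ∀ S : Set ι, IsClosed (⋃ k ∈ S, K k) := fun S =>
    (toFinite S).isClosed_biUnion fun k _ => hK k
  obtain ⟨x, hxC, hx, hx'⟩ := isPreconnected_closed_iff.1 hC (⋃ k ∈ {k | G.Reachable i k}, K k)
    (⋃ k ∈ {k | ¬G.Reachable i k}, K k) (hclosed _) (hclosed _)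
    (fun x hx => by
      obtain ⟨k, hk⟩ := mem_iUnion.1 (hcover hx)
      exact (em (G.Reachable i k)).imp (fun h => mem_biUnion h hk) fun h => mem_biUnion h hk)
    ((hmeet i).mono (inter_subset_inter_right C
      (subset_biUnion_of_mem (u := K) (SimpleGraph.Reachable.refl i))))
    ((hmeet j).mono (inter_subset_inter_right C (subset_biUnion_of_mem (u := K) hij)))
  obtain ⟨k, hk, hxk⟩ := mem_iUnion₂.1 hx
  obtain ⟨l, hl, hxl⟩ := mem_iUnion₂.1 hx'
  have hkl : k ≠ l := fun h => hl (h ▸ hk)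
  exact hl (hk.trans (hG k l hkl ⟨x, hxC, hxk, hxl⟩).reachable)

theorem subset_of_disjoint_frontier {X : Type*} [TopologicalSpace X] {U C : Set X}
    (hU : IsPreconnected U) (hdisj : Disjoint U (frontier C)) (hne : (U ∩ C).Nonempty) :
    U ⊆ C := by
  have hint : U ∩ closure C ⊆ interior C := fun x hx =>
    by_contra fun h => disjoint_left.1 hdisj hx.1 ⟨hx.2, h⟩
  have hsub := hU.subset_of_closure_inter_subset isOpen_interior
    (hne.mono fun x hx => ⟨hx.1, hint ⟨hx.1, subset_closure hx.2⟩⟩)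
    fun x hx => hint ⟨hx.2, closure_mono interior_subset hx.1⟩
  exact hsub.trans interior_subset

variable {E : Type*} [NormedAddCommGroup E] [InnerProductSpace ℝ E]

theorem isPreconnected_ball_diff_countable (h : 1 < Module.rank ℝ E) {V : Set E}
    (hV : V.Countable) (x : E) {r : ℝ} (hr : 0 < r) :
    IsPreconnected (Metric.ball x r \ V) := by
  set φ := OpenPartialHomeomorph.univBall x r
  have hsource : φ.source = univ := OpenPartialHomeomorph.univBall_source x r
  have htarget : φ.target = Metric.ball x r := OpenPartialHomeomorph.univBall_target x hr
  have hinj : Function.Injective φ := fun a b hab =>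
    φ.injOn (hsource ▸ mem_univ a) (hsource ▸ mem_univ b) hab
  have hcompl := ((hV.preimage hinj).isConnected_compl_of_one_lt_rank h).isPreconnected
  have himage : φ '' (φ ⁻¹' V)ᶜ = Metric.ball x r \ V := by
    rw [← preimage_compl, image_preimage_eq_inter_range, inter_comm, ← image_univ, ← hsource,
      φ.image_source_eq_target, htarget, sdiff_eq]
  exact himage ▸ hcompl.image φ (OpenPartialHomeomorph.continuous_univBall x r).continuousOn

theorem isPreconnected_diff_countable (h : 1 < Module.rank ℝ E) {U V : Set E}
    (hU : IsOpen U) (hc : IsPreconnected U) (hV : V.Countable) : IsPreconnected (U \ V) := by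
  have : Nontrivial E := rank_pos_iff_nontrivial.1 (zero_lt_one.trans h)
  rw [isPreconnected_iff_subset_of_disjoint]
  intro A B hA hB hAB hdisj
  have hor := isPreconnected_iff_subset_of_disjoint.1 hc (interior (A ∪ V)) (interior (B ∪ V))
    isOpen_interior isOpen_interior ?_ ?_
  · have hsub : ∀ C : Set E, U ⊆ interior (C ∪ V) → U \ V ⊆ C := fun C hC x hx =>
      (interior_subset (hC hx.1)).resolve_right hx.2
    exact hor.imp (hsub A) (hsub B)
  · intro x hx
    obtain ⟨r, hr, hball⟩ := Metric.isOpen_iff.1 hU x hx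
    have hlocal := isPreconnected_iff_subset_of_disjoint.1
      (isPreconnected_ball_diff_countable h hV x hr) A B hA hB
      ((sdiff_subset_sdiff_left hball).trans hAB)
      (subset_empty_iff.1 (hdisj ▸ inter_subset_inter_left _ (sdiff_subset_sdiff_left hball)))
    have hnhds : ∀ C : Set E, Metric.ball x r \ V ⊆ C → x ∈ interior (C ∪ V) := fun C hC =>
      mem_interior.2 ⟨Metric.ball x r, by
        rw [union_comm]
        exact sdiff_subset_iff.1 hC, Metric.isOpen_ball, Metric.mem_ball_self hr⟩
    exact hlocal.imp (hnhds A) (hnhds B)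
  · by_contra hne
    obtain ⟨x, ⟨hxU, hxA, hxB⟩, hxV⟩ := (hV.dense_compl ℝ).inter_open_nonempty _
      (hU.inter (isOpen_interior.inter isOpen_interior)) (nonempty_iff_ne_empty.2 hne)
    exact (hdisj.subset ⟨⟨hxU, hxV⟩, (interior_subset hxA).resolve_right hxV,
      (interior_subset hxB).resolve_right hxV⟩ : x ∈ (∅ : Set E))

end Connectedness

theorem finrank_plane : Module.finrank ℝ Plane = 2 := finrank_euclideanSpace_fin

theorem one_lt_rank_plane : 1 < Module.rank ℝ Plane := by
  rw [← Module.finrank_eq_rank, finrank_plane]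
  norm_num

section FiniteComplex

variable {E : Type*} [NormedAddCommGroup E] [NormedSpace ℝ E] {Δ : SimplicialComplex ℝ E}

theorem finite_vertices (h : Δ.faces.Finite) : Δ.vertices.Finite :=
  h.preimage Finset.singleton_injective.injOn

theorem mem_vertices_of_mem {s : Finset E} (hs : s ∈ Δ.faces) {x : E} (hx : x ∈ s) :
    x ∈ Δ.vertices :=
  Δ.down_closed hs (Finset.singleton_subset_iff.2 hx) (Finset.singleton_nonempty x)

theorem isCompact_convexHull_finset (s : Finset E) : IsCompact (convexHull ℝ (s : Set E)) :=
  s.finite_toSet.isCompact_convexHull ℝ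

theorem isCompact_biUnion_convexHull {S : Set (Finset E)} (hS : S.Finite) :
    IsCompact (⋃ s ∈ S, convexHull ℝ (s : Set E)) :=
  hS.isCompact_biUnion fun s _ => isCompact_convexHull_finset s

theorem isCompact_space (h : Δ.faces.Finite) : IsCompact Δ.space := isCompact_biUnion_convexHull h

end FiniteComplex

section Complex

variable {Δ : SimplicialComplex ℝ Plane} {Ω : Set Plane} {e s t : Finset Plane} {p : Plane}

theorem finite_triangles (h : Δ.faces.Finite) : (triangles Δ).Finite := h.subset fun _ ht => ht.1

theorem finite_edges (h : Δ.faces.Finite) : (edges Δ).Finite := h.subset fun _ he => he.1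

theorem mem_edges_of_subset (ht : t ∈ triangles Δ) (het : e ⊆ t) (he : e.card = 2) :
    e ∈ edges Δ :=
  ⟨Δ.down_closed ht.1 het (Finset.card_pos.1 (by omega)), he⟩

theorem card_triangle (ht : t ∈ triangles Δ) : t.card = Module.finrank ℝ Plane + 1 :=
  ht.2.trans (by rw [finrank_plane])

theorem interior_convexHull_triangle (ht : t ∈ triangles Δ) :
    interior (convexHull ℝ (t : Set Plane)) = openSimplex ℝ t :=
  interior_convexHull_eq_openSimplex (Δ.indep ht.1) (card_triangle ht)

theorem eq_or_mem_edges_of_subset (ht : t ∈ triangles Δ) (hst : s ⊆ t) (hp : p ∈ openSimplex ℝ s)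
    (hv : p ∉ Δ.vertices) : s = t ∨ s ∈ edges Δ := by
  have hle := Finset.card_le_card hst
  have hpos := (nonempty_of_mem_openSimplex hp).card_pos
  have hne : s.card ≠ 1 := fun h => by
    obtain ⟨v, rfl⟩ := Finset.card_eq_one.1 h
    obtain rfl : p = v := by simpa using openSimplex_subset_convexHull _ hp
    exact hv (mem_vertices_of_mem ht.1 (Finset.singleton_subset_iff.1 hst))
  by_cases h2 : s.card = 2
  · exact Or.inr (mem_edges_of_subset ht hst h2)
  · exact Or.inl (Finset.eq_of_subset_of_card_le hst (by have := ht.2; omega))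

/-- The inner edges of `Δ`: the edges that lie on two triangles. -/
def innerEdges (Δ : SimplicialComplex ℝ Plane) : Set (Finset Plane) :=
  {e | e ∈ edges Δ ∧ ∃ s ∈ triangles Δ, ∃ t ∈ triangles Δ, s ≠ t ∧ e ⊆ s ∧ e ⊆ t}

theorem mem_boundaryEdges_or_mem_innerEdges (he : e ∈ edges Δ) (ht : t ∈ triangles Δ)
    (het : e ⊆ t) : e ∈ boundaryEdges Δ ∨ e ∈ innerEdges Δ := by
  by_cases h : ∃ s ∈ triangles Δ, t ≠ s ∧ e ⊆ s
  · obtain ⟨s, hs, hts, hes⟩ := h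
    exact Or.inr ⟨he, t, ht, s, hs, hts, het, hes⟩
  · push Not at h
    exact Or.inl ⟨he, t, ⟨ht, het⟩, fun s hs => by_contra fun hst => h s hs.1 (Ne.symm hst) hs.2⟩

theorem disjoint_boundaryEdges_innerEdges : Disjoint (boundaryEdges Δ) (innerEdges Δ) :=
  disjoint_left.2 fun _ hb ⟨_, _, hs, _, ht, hst, hes, het⟩ =>
    hst (hb.2.unique ⟨hs, hes⟩ ⟨ht, het⟩)

theorem eq_or_eq_or_eq_of_edge_subset {t₁ t₂ t₃ : Finset Plane} (he : e ∈ edges Δ)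
    (h₁ : t₁ ∈ triangles Δ) (h₂ : t₂ ∈ triangles Δ) (h₃ : t₃ ∈ triangles Δ) (he₁ : e ⊆ t₁)
    (he₂ : e ⊆ t₂) (he₃ : e ⊆ t₃) : t₁ = t₂ ∨ t₁ = t₃ ∨ t₂ = t₃ :=
  eq_or_eq_or_eq_of_facet_subset
    ⟨_, barycenter_mem_openSimplex (SimplicialComplex.nonempty_of_mem_faces he.1)⟩
    (he.2.trans finrank_plane.symm) h₁.1 h₂.1 h₃.1 (card_triangle h₁) (card_triangle h₂)
    (card_triangle h₃) he₁ he₂ he₃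

theorem openSimplex_triangle_subset_interior_space (ht : t ∈ triangles Δ) :
    openSimplex ℝ t ⊆ interior Δ.space :=
  interior_convexHull_triangle ht ▸
    interior_mono (SimplicialComplex.convexHull_subset_space ht.1)

theorem openSimplex_innerEdge_subset_interior_space (he : e ∈ innerEdges Δ) :
    openSimplex ℝ e ⊆ interior Δ.space := by
  obtain ⟨he, s, hs, t, ht, hst, hes, het⟩ := he
  exact fun p hp => mem_interior_space_of_facet hs.1 ht.1 hst (card_triangle hs)
    (card_triangle ht) (he.2.trans finrank_plane.symm) hes het hp

theorem exists_triangle_of_mem_space (hΔ : IsTriangulationOf Δ Ω) (hp : p ∈ Δ.space) :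
    ∃ t ∈ triangles Δ, p ∈ convexHull ℝ (t : Set Plane) := by
  set K : Set Plane := ⋃ t ∈ triangles Δ, convexHull ℝ (t : Set Plane) with hK
  have hKc : IsClosed K :=
    (isCompact_biUnion_convexHull (finite_triangles hΔ.finite_faces)).isClosed
  have hsub : Ω ⊆ K := by
    by_contra hne
    obtain ⟨x, hxΩ, hxK⟩ := not_subset.1 hne
    have hdense := dense_biInter_of_isOpen (S := {s | s ∈ Δ.faces ∧ s.card ≠ 3})
      (f := fun s : Finset Plane => (convexHull ℝ (s : Set Plane))ᶜ)
      (fun s _ => (isCompact_convexHull_finset s).isClosed.isOpen_compl)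
      (hΔ.finite_faces.subset fun _ h => h.1).countable
      (fun s hs => interior_eq_empty_iff_dense_compl.1
        (interior_convexHull_eq_empty (Δ.indep hs.1) (by rw [finrank_plane]; exact hs.2)))
    obtain ⟨y, ⟨hyΩ, hyK⟩, hy⟩ := hdense.inter_open_nonempty _
      (hΔ.isOpen.inter hKc.isOpen_compl) ⟨x, hxΩ, hxK⟩
    obtain ⟨s, hs, hys⟩ := SimplicialComplex.mem_space_iff.1 (hΔ.space_eq ▸ subset_closure hyΩ)
    by_cases hcard : s.card = 3
    · exact hyK (mem_biUnion (show s ∈ triangles Δ from ⟨hs, hcard⟩) hys)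
    · exact mem_iInter₂.1 hy s ⟨hs, hcard⟩ hys
  rw [hΔ.space_eq] at hp
  simpa [hK] using closure_minimal hsub hKc hp

theorem nonempty_triangles (hΔ : IsTriangulationOf Δ Ω) : (triangles Δ).Nonempty := by
  obtain ⟨x, hx⟩ := hΔ.isConnected.nonempty
  obtain ⟨t, ht, -⟩ := exists_triangle_of_mem_space hΔ (hΔ.space_eq ▸ subset_closure hx)
  exact ⟨t, ht⟩

theorem exists_triangle_of_mem_vertices (hΔ : IsTriangulationOf Δ Ω) (hp : p ∈ Δ.vertices) :
    ∃ t ∈ triangles Δ, p ∈ t := by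
  obtain ⟨t, ht, hpt⟩ := exists_triangle_of_mem_space hΔ
    (SimplicialComplex.vertices_subset_space hp)
  exact ⟨t, ht, (SimplicialComplex.vertex_mem_convexHull_iff hp ht.1).1 hpt⟩

theorem mem_interior_space (hΔ : IsTriangulationOf Δ Ω) (hp : p ∈ Δ.space) (hv : p ∉ Δ.vertices)
    (hb : p ∉ ⋃ e ∈ boundaryEdges Δ, convexHull ℝ (e : Set Plane)) : p ∈ interior Δ.space := by
  obtain ⟨t, ht, hpt⟩ := exists_triangle_of_mem_space hΔ hp
  obtain ⟨s, hst, hps⟩ := exists_subset_mem_openSimplex hpt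
  obtain rfl | he := eq_or_mem_edges_of_subset ht hst hps hv
  · exact openSimplex_triangle_subset_interior_space ht hps
  · obtain hs | hs := mem_boundaryEdges_or_mem_innerEdges he ht hst
    · exact absurd (mem_biUnion hs (openSimplex_subset_convexHull s hps)) hb
    · exact openSimplex_innerEdge_subset_interior_space hs hps

theorem frontier_space_subset (hΔ : IsTriangulationOf Δ Ω) :
    frontier Δ.space ⊆ ⋃ e ∈ boundaryEdges Δ, convexHull ℝ (e : Set Plane) := by
  intro v hv
  have hclosed := (isCompact_space hΔ.finite_faces).isClosed
  have hVc := (finite_vertices hΔ.finite_faces).countable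
  set B : Set Plane := ⋃ e ∈ boundaryEdges Δ, convexHull ℝ (e : Set Plane)
  have hB : IsClosed B := (isCompact_biUnion_convexHull
    ((finite_edges hΔ.finite_faces).subset fun _ he => he.1)).isClosed
  by_contra hvB
  obtain ⟨r, hr, hball⟩ := Metric.isOpen_iff.1 hB.isOpen_compl v hvB
  have hpunctured := isPreconnected_diff_countable one_lt_rank_plane
    (Metric.isOpen_ball (x := v) (ε := r)) (convex_ball v r).isPreconnected hVc
  have hsub : Metric.ball v r \ Δ.vertices ⊆ Δ.space := by
    refine subset_of_disjoint_frontier hpunctured (disjoint_left.2 fun z hz hzf => hzf.2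
      (mem_interior_space hΔ (hclosed.frontier_subset hzf) hz.2 (hball hz.1))) ?_
    obtain ⟨x, ⟨hxr, hxΩ⟩, hxV⟩ := (hVc.dense_compl ℝ).inter_open_nonempty _
      (Metric.isOpen_ball.inter hΔ.isOpen) (mem_closure_iff.1
        (hΔ.space_eq ▸ hclosed.frontier_subset hv) _ Metric.isOpen_ball (Metric.mem_ball_self hr))
    exact ⟨x, ⟨hxr, hxV⟩, hΔ.space_eq ▸ subset_closure hxΩ⟩
  have hball_sub : Metric.ball v r ⊆ Δ.space :=
    ((hVc.dense_compl ℝ).open_subset_closure_inter Metric.isOpen_ball).trans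
      (closure_minimal hsub hclosed)
  exact hv.2 (mem_interior.2 ⟨_, hball_sub, Metric.isOpen_ball, Metric.mem_ball_self hr⟩)

theorem subset_space_of_disjoint_boundaryEdges (hΔ : IsTriangulationOf Δ Ω) {U : Set Plane}
    (hU : IsPreconnected U)
    (hb : Disjoint U (⋃ e ∈ boundaryEdges Δ, convexHull ℝ (e : Set Plane)))
    (hne : (U ∩ Δ.space).Nonempty) : U ⊆ Δ.space :=
  subset_of_disjoint_frontier hU (hb.mono_right (frontier_space_subset hΔ)) hne

theorem dualGraph_adj_of_mem_convexHull {s t : triangles Δ} (hst : s ≠ t)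
    (hps : p ∈ convexHull ℝ (s.1 : Set Plane)) (hpt : p ∈ convexHull ℝ (t.1 : Set Plane))
    (hv : p ∉ Δ.vertices) : (dualGraph Δ).Adj s t := by
  obtain ⟨e, hes, hpe⟩ := exists_subset_mem_openSimplex hps
  have he := eq_or_mem_edges_of_subset s.2 hes hpe hv
  have hface : e ∈ Δ.faces := he.elim (fun h => h ▸ s.2.1) fun h => h.1
  have het := subset_of_mem_openSimplex hface t.2.1 hpe hpt
  obtain rfl | he := he
  · exact absurd (Subtype.ext (Finset.eq_of_subset_of_card_le het (by rw [s.2.2, t.2.2]))) hst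
  · exact ⟨hst, e, he, hes, het⟩

theorem dualGraph_preconnected (hΔ : IsTriangulationOf Δ Ω) : (dualGraph Δ).Preconnected := by
  have hVc := (finite_vertices hΔ.finite_faces).countable
  have := (finite_triangles hΔ.finite_faces).to_subtype
  refine preconnected_of_closed_cover (isPreconnected_diff_countable one_lt_rank_plane hΔ.isOpen
    hΔ.isConnected.isPreconnected hVc) (K := fun t : triangles Δ => convexHull ℝ (t.1 : Set Plane))
    (fun t => (isCompact_convexHull_finset t.1).isClosed) (fun x hx => ?_) (fun t => ?_)
    fun s t hst ⟨x, hx, hxs, hxt⟩ => dualGraph_adj_of_mem_convexHull hst hxs hxt hx.2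
  · obtain ⟨t, ht, hxt⟩ := exists_triangle_of_mem_space hΔ (hΔ.space_eq ▸ subset_closure hx.1)
    exact mem_iUnion.2 ⟨⟨t, ht⟩, hxt⟩
  · have hbary := interior_convexHull_triangle t.2 ▸
      barycenter_mem_openSimplex (SimplicialComplex.nonempty_of_mem_faces t.2.1)
    have hclosure : barycenter t.1 ∈ closure Ω := hΔ.space_eq ▸
      SimplicialComplex.convexHull_subset_space t.2.1 (interior_subset hbary)
    obtain ⟨x, ⟨hxt, hxΩ⟩, hxV⟩ := (hVc.dense_compl ℝ).inter_open_nonempty _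
      (isOpen_interior.inter hΔ.isOpen) (mem_closure_iff.1 hclosure _ isOpen_interior hbary)
    exact ⟨x, ⟨hxΩ, hxV⟩, interior_subset hxt⟩

end Complex

section HalfSpaces

variable {E : Type*} [NormedAddCommGroup E] [NormedSpace ℝ E]

theorem not_isBounded_halfSpace {f : E →L[ℝ] ℝ} (hf : f ≠ 0) (u : ℝ) :
    ¬Bornology.IsBounded {x | u < f x} := by
  have hsurj : Function.Surjective f :=
    f.toLinearMap.surjective (fun h => hf (ContinuousLinearMap.coe_injective h))
  have himage : f '' {x | u < f x} = Ioi u := image_preimage_eq (Ioi u) hsurj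
  intro h
  exact not_bddAbove_Ioi u (himage ▸ (f.lipschitz.isBounded_image h).bddAbove)

theorem exists_segment_disjoint_interior {K : Set E} (hK : IsCompact K) (hne : K.Nonempty) {p : E}
    (hp : p ∉ interior K) : ∃ q ∈ K, Disjoint (segment ℝ p q) (interior K) := by
  obtain ⟨q, hqK, hq⟩ := hK.exists_infDist_eq_dist hne p
  refine ⟨q, hqK, disjoint_left.2 fun x hx hxK => ?_⟩
  have hle : dist x p ≤ dist q p :=
    (convex_closedBall p (dist q p)).segment_subset
      (Metric.mem_closedBall_self dist_nonneg) (Metric.mem_closedBall.2 le_rfl) hx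
  have hxp : 0 < dist x p := dist_pos.2 fun h => hp (h ▸ hxK)
  have hlim : Tendsto (fun r : ℝ => AffineMap.lineMap x p r) (𝓝[>] 0) (𝓝 x) := by
    have hcont : Continuous (fun r : ℝ => AffineMap.lineMap x p r) := AffineMap.lineMap_continuous
    simpa using (hcont.tendsto 0).mono_left (nhdsWithin_le_nhds (s := Ioi 0))
  obtain ⟨r, hr, hr0, hr1⟩ := ((hlim.eventually (mem_interior_iff_mem_nhds.1 hxK)).and
    (Ioo_mem_nhdsGT one_pos)).exists
  have hcloser : dist (AffineMap.lineMap x p r) p < dist x p := by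
    rw [dist_lineMap_right, Real.norm_of_nonneg (by linarith)]
    exact mul_lt_of_lt_one_left hxp (by linarith)
  have hnearest : dist q p ≤ dist (AffineMap.lineMap x p r) p := by
    rw [dist_comm q, ← hq, dist_comm _ p]
    exact Metric.infDist_le_dist_of_mem hr
  linarith

end HalfSpaces

section Drawing

variable {Δ : SimplicialComplex ℝ Plane} {e s t : Finset Plane} {p : Plane}

theorem mem_dualDrawing_cases (hp : p ∈ dualDrawing Δ) :
    (∃ t ∈ triangles Δ, p = barycenter t) ∨
      ∃ s ∈ triangles Δ, ∃ e ∈ innerEdges Δ, e ⊆ s ∧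
        p ∈ segment ℝ (barycenter s) (barycenter e) := by
  obtain h | ⟨s, hs, t, ht, e, he, hst, hes, het, h | h⟩ := hp
  · exact Or.inl h
  · exact Or.inr ⟨s, hs, e, ⟨he, s, hs, t, ht, hst, hes, het⟩, hes, h⟩
  · exact Or.inr ⟨t, ht, e, ⟨he, s, hs, t, ht, hst, hes, het⟩, het, by rwa [segment_symm]⟩

theorem mem_openSimplex_of_mem_dualDrawing (hp : p ∈ dualDrawing Δ) :
    ∃ s, (s ∈ triangles Δ ∨ s ∈ innerEdges Δ) ∧ p ∈ openSimplex ℝ s := by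
  obtain ⟨t, ht, rfl⟩ | ⟨s, hs, e, he, hes, hpe⟩ := mem_dualDrawing_cases hp
  · exact ⟨t, Or.inl ht,
      barycenter_mem_openSimplex (SimplicialComplex.nonempty_of_mem_faces ht.1)⟩
  · have hbs := barycenter_mem_openSimplex (SimplicialComplex.nonempty_of_mem_faces hs.1)
    have hbe := barycenter_mem_openSimplex (SimplicialComplex.nonempty_of_mem_faces he.1.1)
    obtain rfl | hpe' := eq_or_ne p (barycenter e)
    · exact ⟨e, Or.inr he, hbe⟩
    · refine ⟨s, Or.inl hs, ?_⟩
      obtain rfl | hps := eq_or_ne p (barycenter s)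
      · exact hbs
      · rw [← interior_convexHull_triangle hs] at hbs ⊢
        exact (convex_convexHull ℝ _).openSegment_interior_self_subset_interior hbs
          (convexHull_mono hes (openSimplex_subset_convexHull e hbe))
          (mem_openSegment_of_ne_left_right hps.symm hpe'.symm hpe)

theorem dualDrawing_subset_interior_space : dualDrawing Δ ⊆ interior Δ.space := fun _ hp => by
  obtain ⟨s, hs | hs, hps⟩ := mem_openSimplex_of_mem_dualDrawing hp
  · exact openSimplex_triangle_subset_interior_space hs hps
  · exact openSimplex_innerEdge_subset_interior_space hs hps

theorem notMem_dualDrawing_of_mem_convexHull (hs : s ∈ Δ.faces) (hcard : s.card ≤ 2)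
    (hinner : s ∉ innerEdges Δ) (hp : p ∈ convexHull ℝ (s : Set Plane)) : p ∉ dualDrawing Δ := by
  intro hD
  obtain ⟨t, ht | ht, hpt⟩ := mem_openSimplex_of_mem_dualDrawing hD
  · have := Finset.card_le_card (subset_of_mem_openSimplex ht.1 hs hpt hp)
    have := ht.2
    omega
  · have hts := subset_of_mem_openSimplex ht.1.1 hs hpt hp
    exact hinner (Finset.eq_of_subset_of_card_le hts (hcard.trans_eq ht.1.2.symm) ▸ ht)

theorem notMem_dualDrawing_of_mem_boundaryEdge (he : e ∈ boundaryEdges Δ)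
    (hp : p ∈ convexHull ℝ (e : Set Plane)) : p ∉ dualDrawing Δ :=
  notMem_dualDrawing_of_mem_convexHull he.1.1 he.1.2.le
    (disjoint_left.1 disjoint_boundaryEdges_innerEdges he) hp

/-- On the arcs of the drawing, the two endpoints of the edge which is crossed have the largest
barycentric coordinate. -/
theorem exists_max_attained_twice_of_mem_dualDrawing (hp : p ∈ dualDrawing Δ) :
    ∃ s ∈ triangles Δ, ∃ w : Plane → ℝ, IsBarycentric s w p ∧
      ∃ x y, x ≠ y ∧ w x = w y ∧ ∀ z, w z ≤ w x := by
  classical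
  obtain ⟨t, ht, rfl⟩ | ⟨s, hs, e, he, hes, u, v, hu, hv, huv, rfl⟩ := mem_dualDrawing_cases hp
  · obtain ⟨x, hx, y, hy, hxy⟩ := Finset.one_lt_card.1 (show 1 < t.card by rw [ht.2]; norm_num)
    refine ⟨t, ht, _, isBarycentric_barycenter (SimplicialComplex.nonempty_of_mem_faces ht.1),
      x, y, hxy, by rw [if_pos hx, if_pos hy], fun z => ?_⟩
    rw [if_pos hx]
    split_ifs <;> simp
  · obtain ⟨x, hx, y, hy, hxy⟩ := Finset.one_lt_card.1 (show 1 < e.card by rw [he.1.2]; norm_num)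
    refine ⟨s, hs, _,
      (isBarycentric_barycenter (SimplicialComplex.nonempty_of_mem_faces hs.1)).combine
        ((isBarycentric_barycenter (SimplicialComplex.nonempty_of_mem_faces he.1.1)).mono hes)
        hu hv huv,
      x, y, hxy, by rw [if_pos hx, if_pos hy, if_pos (hes hx), if_pos (hes hy)], fun z => ?_⟩
    rw [if_pos hx, if_pos (hes hx)]
    gcongr <;> split_ifs <;> simp

theorem notMem_dualDrawing_of_lt (ht : t ∈ Δ.faces) {w : Plane → ℝ} (hw : IsBarycentric t w p)
    {v : Plane} (hv : ∀ x, x ≠ v → w x < w v) : p ∉ dualDrawing Δ := by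
  intro hp
  obtain ⟨s, hs, w', hw', x, y, hxy, hxy', hmax⟩ :=
    exists_max_attained_twice_of_mem_dualDrawing hp
  obtain rfl := hw.eq_of_mem_faces ht hs.1 hw'
  obtain rfl | hx := eq_or_ne x v
  · exact (hv y hxy.symm).ne' hxy'
  · exact (hv x hx).not_ge (hmax v)

end Drawing

section Faces

variable {Δ : SimplicialComplex ℝ Plane} {Ω : Set Plane} {e : Finset Plane} {p q : Plane}

/-- The face of the drawing of the dual graph that contains `p`, for a point `p` off the drawing
(the empty set if `p` lies on the drawing). -/
abbrev faceAt (Δ : SimplicialComplex ℝ Plane) (p : Plane) : Set Plane :=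
  connectedComponentIn (dualDrawing Δ)ᶜ p

theorem faceAt_eq_of_segment (h : segment ℝ p q ⊆ (dualDrawing Δ)ᶜ) : faceAt Δ p = faceAt Δ q :=
  connectedComponentIn_eq ((convex_segment p q).isPreconnected.subset_connectedComponentIn
    (left_mem_segment ℝ p q) h (right_mem_segment ℝ p q))

theorem faceAt_eq_of_mem_boundaryEdge (he : e ∈ boundaryEdges Δ) (hp : p ∈ e) (hq : q ∈ e) :
    faceAt Δ p = faceAt Δ q :=
  faceAt_eq_of_segment fun _ hx => notMem_dualDrawing_of_mem_boundaryEdge he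
    (segment_subset_convexHull hp hq hx)

theorem exists_vertex_faceAt_eq_of_mem_space (hΔ : IsTriangulationOf Δ Ω) (hp : p ∈ Δ.space)
    (hpD : p ∉ dualDrawing Δ) : ∃ v ∈ Δ.vertices, faceAt Δ p = faceAt Δ v := by
  classical
  obtain ⟨t, ht, hpt⟩ := exists_triangle_of_mem_space hΔ hp
  obtain ⟨w, hw⟩ := exists_isBarycentric hpt
  obtain ⟨v, hv, hmax⟩ := t.exists_max_image w (SimplicialComplex.nonempty_of_mem_faces ht.1)
  have hle : ∀ x, w x ≤ w v := fun x => by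
    by_cases hx : x ∈ t
    · exact hmax x hx
    · exact (hw.eq_zero x hx).trans_le (hw.nonneg v)
  refine ⟨v, mem_vertices_of_mem ht.1 hv, faceAt_eq_of_segment ?_⟩
  rintro _ ⟨α, β, hα, hβ, hαβ, rfl⟩
  obtain rfl | hβ := hβ.eq_or_lt
  · rw [add_zero] at hαβ
    rwa [hαβ, one_smul, zero_smul, add_zero]
  · refine notMem_dualDrawing_of_lt ht.1 (hw.combine (isBarycentric_single hv) hα hβ.le hαβ)
      (v := v) fun x hx => ?_
    simp only [if_neg hx, if_true, mul_zero, mul_one, add_zero]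
    exact lt_add_of_le_of_pos (mul_le_mul_of_nonneg_left (hle x) hα) hβ

theorem exists_vertex_faceAt_eq (hΔ : IsTriangulationOf Δ Ω) (hp : p ∉ dualDrawing Δ) :
    ∃ v ∈ Δ.vertices, faceAt Δ p = faceAt Δ v := by
  by_cases hps : p ∈ Δ.space
  · exact exists_vertex_faceAt_eq_of_mem_space hΔ hps hp
  · obtain ⟨q, hq, hdisj⟩ := exists_segment_disjoint_interior (isCompact_space hΔ.finite_faces)
      (hΔ.space_eq ▸ hΔ.isConnected.nonempty.closure) (mt (@interior_subset _ _ Δ.space p) hps)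
    have hseg : segment ℝ p q ⊆ (dualDrawing Δ)ᶜ :=
      (hdisj.mono_right dualDrawing_subset_interior_space).subset_compl_right
    rw [faceAt_eq_of_segment hseg]
    exact exists_vertex_faceAt_eq_of_mem_space hΔ hq (hseg (right_mem_segment ℝ p q))

theorem finite_dualBoundedFaces (hΔ : IsTriangulationOf Δ Ω) : (dualBoundedFaces Δ).Finite := by
  refine ((finite_vertices hΔ.finite_faces).image (faceAt Δ)).subset ?_
  rintro _ ⟨-, p, hp, rfl⟩
  obtain ⟨v, hv, h⟩ := exists_vertex_faceAt_eq hΔ hp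
  exact ⟨v, hv, h.symm⟩

theorem exists_vertex_faceAt_notMem_dualBoundedFaces (hΔ : IsTriangulationOf Δ Ω) :
    ∃ v ∈ Δ.vertices, faceAt Δ v ∉ dualBoundedFaces Δ := by
  let f : Plane →L[ℝ] ℝ := EuclideanSpace.proj 0
  have hf : f ≠ 0 := fun h => by
    simpa [f] using DFunLike.congr_fun h (EuclideanSpace.single 0 1)
  obtain ⟨u, hu⟩ := (isCompact_space hΔ.finite_faces).bddAbove_image f.continuous.continuousOn
  have hunbounded := not_isBounded_halfSpace hf u
  have hoff : {x | u < f x} ⊆ (dualDrawing Δ)ᶜ := fun x hx hxD =>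
    (hu (mem_image_of_mem f (interior_subset (dualDrawing_subset_interior_space hxD)))).not_gt hx
  obtain ⟨p, hp⟩ := nonempty_iff_ne_empty.2 fun h : {x | u < f x} = ∅ =>
    hunbounded (h ▸ Bornology.isBounded_empty)
  obtain ⟨v, hv, hpv⟩ := exists_vertex_faceAt_eq hΔ (hoff hp)
  have hconvex : Convex ℝ {x | u < f x} := convex_halfSpace_gt f.toLinearMap.isLinear u
  exact ⟨v, hv, fun h => hunbounded ((hpv ▸ h.1).subset
    (hconvex.isPreconnected.subset_connectedComponentIn hp hoff))⟩

end Faces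

section Counting

variable {Δ : SimplicialComplex ℝ Plane} {e s t u : Finset Plane}

theorem finite_boundaryEdges (h : Δ.faces.Finite) : (boundaryEdges Δ).Finite :=
  (finite_edges h).subset fun _ he => he.1

theorem finite_innerEdges (h : Δ.faces.Finite) : (innerEdges Δ).Finite :=
  (finite_edges h).subset fun _ he => he.1

theorem edge_subset_iff (he : e ∈ edges Δ) (hs : s ∈ triangles Δ) (ht : t ∈ triangles Δ)
    (hu : u ∈ triangles Δ) (hst : s ≠ t) (hes : e ⊆ s) (het : e ⊆ t) :
    e ⊆ u ↔ u = s ∨ u = t := by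
  refine ⟨fun heu => ?_, by rintro (rfl | rfl) <;> assumption⟩
  obtain h | h | h := eq_or_eq_or_eq_of_edge_subset he hu hs ht heu hes het
  · exact Or.inl h
  · exact Or.inr h
  · exact absurd h hst

theorem card_triangles_filter_of_mem_boundaryEdges [DecidableEq Plane] (h : Δ.faces.Finite)
    (he : e ∈ boundaryEdges Δ) : ((finite_triangles h).toFinset.filter (e ⊆ ·)).card = 1 := by
  obtain ⟨-, t, ht, huniq⟩ := he
  refine Finset.card_eq_one.2 ⟨t, Finset.ext fun u => ?_⟩
  rw [Finset.mem_filter, Finite.mem_toFinset, Finset.mem_singleton]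
  exact ⟨huniq u, fun hu => hu ▸ ht⟩

theorem card_triangles_filter_of_mem_innerEdges [DecidableEq Plane] (h : Δ.faces.Finite)
    (he : e ∈ innerEdges Δ) : ((finite_triangles h).toFinset.filter (e ⊆ ·)).card = 2 := by
  obtain ⟨he, s, hs, t, ht, hst, hes, het⟩ := he
  refine Finset.card_eq_two.2 ⟨s, t, hst, Finset.ext fun u => ?_⟩
  rw [Finset.mem_filter, Finite.mem_toFinset, Finset.mem_insert, Finset.mem_singleton]
  refine ⟨fun hu => (edge_subset_iff he hs ht hu.1 hst hes het).1 hu.2, ?_⟩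
  rintro (rfl | rfl)
  exacts [⟨hs, hes⟩, ⟨ht, het⟩]

theorem sum_triangles_sum_edges {M : Type*} [AddCommMonoid M] (h : Δ.faces.Finite)
    (φ : Finset Plane → M) :
    ∑ t ∈ (finite_triangles h).toFinset, ∑ e ∈ t.powersetCard 2, φ e =
      ∑ e ∈ (finite_boundaryEdges h).toFinset, φ e +
        2 • ∑ e ∈ (finite_innerEdges h).toFinset, φ e := by
  classical
  set T := (finite_triangles h).toFinset with hT
  set B := (finite_boundaryEdges h).toFinset with hB
  set I := (finite_innerEdges h).toFinset with hI
  have hdisj : Disjoint B I := by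
    rw [← Finset.disjoint_coe, Finite.coe_toFinset, Finite.coe_toFinset]
    exact disjoint_boundaryEdges_innerEdges
  have hswap : ∑ t ∈ T, ∑ e ∈ t.powersetCard 2, φ e =
      ∑ e ∈ B ∪ I, ∑ _t ∈ T.filter (e ⊆ ·), φ e := by
    refine Finset.sum_comm' fun t e => ?_
    simp only [hT, hB, hI, Finset.mem_powersetCard, Finset.mem_filter, Finset.mem_union,
      Finite.mem_toFinset]
    refine ⟨fun ⟨ht, het, hcard⟩ => ⟨⟨ht, het⟩, ?_⟩, fun ⟨⟨ht, het⟩, he⟩ => ⟨ht, het, ?_⟩⟩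
    · exact mem_boundaryEdges_or_mem_innerEdges (mem_edges_of_subset ht het hcard) ht het
    · exact he.elim (fun he => he.1.2) fun he => he.1.2
  rw [hswap, Finset.sum_union hdisj, Finset.smul_sum]
  congr 1 <;> refine Finset.sum_congr rfl fun e he => ?_
  · rw [Finset.sum_const, card_triangles_filter_of_mem_boundaryEdges h
      ((finite_boundaryEdges h).mem_toFinset.1 he), one_smul]
  · rw [Finset.sum_const, card_triangles_filter_of_mem_innerEdges h
      ((finite_innerEdges h).mem_toFinset.1 he)]

theorem three_mul_ncard_triangles (h : Δ.faces.Finite) :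
    3 * (triangles Δ).ncard = (boundaryEdges Δ).ncard + 2 * (innerEdges Δ).ncard := by
  have hthree : ∀ t ∈ (finite_triangles h).toFinset, ∑ e ∈ t.powersetCard 2, 1 = 3 := fun t ht => by
    rw [Finset.sum_const, Finset.card_powersetCard, ((finite_triangles h).mem_toFinset.1 ht).2]
    rfl
  have hsum := sum_triangles_sum_edges h fun _ => 1
  rw [Finset.sum_const_nat hthree, Finset.sum_const, Finset.sum_const, smul_eq_mul, smul_eq_mul,
    smul_eq_mul, mul_one, mul_one] at hsum
  rw [ncard_eq_toFinset_card _ (finite_triangles h),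
    ncard_eq_toFinset_card _ (finite_boundaryEdges h),
    ncard_eq_toFinset_card _ (finite_innerEdges h), ← hsum, mul_comm]

theorem sum_edges_sum_vertices {M : Type*} [AddCommMonoid M] (ht : t ∈ triangles Δ)
    (φ : Plane → M) : ∑ e ∈ t.powersetCard 2, ∑ x ∈ e, φ x = 2 • ∑ x ∈ t, φ x := by
  rw [sum_powersetCard_succ_sum, ht.2]
  rfl

theorem even_card_boundaryEdges_filter [DecidableEq Plane] (h : Δ.faces.Finite) (v : Plane) :
    Even ((finite_boundaryEdges h).toFinset.filter (v ∈ ·)).card := by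
  have hsum := sum_triangles_sum_edges h fun e => ∑ x ∈ e, if x = v then 1 else 0
  rw [Finset.sum_congr rfl fun t ht =>
    sum_edges_sum_vertices ((finite_triangles h).mem_toFinset.1 ht) _, ← Finset.smul_sum] at hsum
  simp only [Finset.sum_ite_eq', smul_eq_mul, ← Finset.card_filter] at hsum
  exact (Nat.even_add.1 (hsum ▸ even_two_mul _)).2 (even_two_mul _)

theorem inter_eq_of_edge_subset [DecidableEq Plane] (he : e ∈ edges Δ) (hs : s ∈ triangles Δ)
    (ht : t ∈ triangles Δ) (hst : s ≠ t) (hes : e ⊆ s) (het : e ⊆ t) : s ∩ t = e := by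
  refine (Finset.eq_of_subset_of_card_le (Finset.subset_inter hes het) ?_).symm
  have hssub : s ∩ t ⊂ s := Finset.inter_subset_left.ssubset_of_ne fun h =>
    hst (Finset.eq_of_subset_of_card_le (Finset.inter_eq_left.1 h) (ht.2.trans_le hs.2.ge))
  have := Finset.card_lt_card hssub
  have := hs.2
  have := he.2
  omega

theorem ncard_innerEdges_le (h : Δ.faces.Finite) :
    (innerEdges Δ).ncard ≤ (dualGraph Δ).edgeSet.ncard := by
  classical
  have := (finite_triangles h).to_subtype
  let sharedEdge : Sym2 (triangles Δ) → Finset Plane :=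
    Sym2.lift ⟨fun s t => s.1 ∩ t.1, fun s t => Finset.inter_comm _ _⟩
  have hsub : innerEdges Δ ⊆ sharedEdge '' (dualGraph Δ).edgeSet := by
    rintro e ⟨he, s, hs, t, ht, hst, hes, het⟩
    exact ⟨s(⟨s, hs⟩, ⟨t, ht⟩), ⟨fun h => hst (congrArg Subtype.val h), e, he, hes, het⟩,
      inter_eq_of_edge_subset he hs ht hst hes het⟩
  exact (ncard_le_ncard hsub (toFinite _)).trans (ncard_image_le (toFinite _))

end Counting

section Euler

variable {Δ : SimplicialComplex ℝ Plane} {Ω : Set Plane} {t : Finset Plane} {x y v : Plane}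

open Classical in
/-- The incidence matrix of triangles and inner edges over `ZMod 2`. Its transpose is the incidence
matrix of the dual graph, in which an inner edge is identified with the dual edge crossing it. -/
noncomputable def incidence (Δ : SimplicialComplex ℝ Plane) :
    Matrix (triangles Δ) (innerEdges Δ) (ZMod 2) :=
  Matrix.of fun t e => if e.1 ⊆ t.1 then 1 else 0

open Classical in
/-- The function on the plane whose value at `x` is the value of `φ` at the bounded face of the
dual graph containing `x`, and `0` where there is no such face. -/
noncomputable def faceValue (Δ : SimplicialComplex ℝ Plane) :
    (dualBoundedFaces Δ → ZMod 2) →ₗ[ZMod 2] Plane → ZMod 2 where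
  toFun φ x := if h : faceAt Δ x ∈ dualBoundedFaces Δ then φ ⟨_, h⟩ else 0
  map_add' φ ψ := by
    funext x
    by_cases h : faceAt Δ x ∈ dualBoundedFaces Δ <;> simp [h]
  map_smul' r φ := by
    funext x
    by_cases h : faceAt Δ x ∈ dualBoundedFaces Δ <;> simp [h]

/-- The coboundary, modulo 2, of a function `φ` on the bounded faces of the dual graph. The edge
dual to an inner edge `xy` separates the faces containing `x` and `y`, so the coboundary takes the
value `faceValue Δ φ x + faceValue Δ φ y` there. -/
noncomputable def faceCoboundary (Δ : SimplicialComplex ℝ Plane) :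
    (dualBoundedFaces Δ → ZMod 2) →ₗ[ZMod 2] innerEdges Δ → ZMod 2 where
  toFun φ e := ∑ x ∈ e.1, faceValue Δ φ x
  map_add' φ ψ := by
    funext e
    simp [Finset.sum_add_distrib]
  map_smul' r φ := by
    funext e
    simp [Finset.mul_sum]

variable {φ : dualBoundedFaces Δ → ZMod 2}

theorem faceValue_eq_zero (h : faceAt Δ x ∉ dualBoundedFaces Δ) : faceValue Δ φ x = 0 :=
  dif_neg h

theorem faceValue_of_faceAt_eq {F : dualBoundedFaces Δ} (h : faceAt Δ x = F) :
    faceValue Δ φ x = φ F := by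
  obtain ⟨F, hF⟩ := F
  subst h
  exact dif_pos hF

theorem faceValue_congr (h : faceAt Δ x = faceAt Δ y) : faceValue Δ φ x = faceValue Δ φ y := by
  by_cases hy : faceAt Δ y ∈ dualBoundedFaces Δ
  · rw [faceValue_of_faceAt_eq (F := ⟨_, hy⟩) h, faceValue_of_faceAt_eq (F := ⟨_, hy⟩) rfl]
  · rw [faceValue_eq_zero hy, faceValue_eq_zero (h ▸ hy)]

theorem sum_faceValue_of_mem_boundaryEdges {e : Finset Plane} (he : e ∈ boundaryEdges Δ) :
    ∑ x ∈ e, faceValue Δ φ x = 0 := by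
  obtain ⟨v, hv⟩ := SimplicialComplex.nonempty_of_mem_faces he.1.1
  rw [Finset.sum_congr rfl fun x hx => faceValue_congr (faceAt_eq_of_mem_boundaryEdge he hx hv),
    Finset.sum_const, he.1.2, CharTwo.two_nsmul]

theorem incidence_mulVec [Fintype (innerEdges Δ)] (ψ : Finset Plane → ZMod 2)
    (hψ : ∀ e ∈ boundaryEdges Δ, ψ e = 0) (t : triangles Δ) :
    (incidence Δ).mulVec (fun e => ψ e) t = ∑ e ∈ t.1.powersetCard 2, ψ e := by
  classical
  simp only [Matrix.mulVec, dotProduct, incidence, Matrix.of_apply, ite_mul, one_mul, zero_mul]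
  rw [← Finset.sum_subtype (innerEdges Δ).toFinset (fun e => mem_toFinset)
    fun e => if e ⊆ t.1 then ψ e else 0, ← Finset.sum_filter]
  refine Finset.sum_subset (fun e he => ?_) fun e he he' => ?_
  · obtain ⟨he, het⟩ := Finset.mem_filter.1 he
    exact Finset.mem_powersetCard.2 ⟨het, (mem_toFinset.1 he).1.2⟩
  · obtain ⟨het, hcard⟩ := Finset.mem_powersetCard.1 he
    obtain h | h := mem_boundaryEdges_or_mem_innerEdges (mem_edges_of_subset t.2 het hcard) t.2 het
    · exact hψ e h
    · exact absurd (Finset.mem_filter.2 ⟨mem_toFinset.2 h, het⟩) he'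

theorem incidence_mulVec_faceCoboundary [Fintype (innerEdges Δ)]
    (φ : dualBoundedFaces Δ → ZMod 2) : (incidence Δ).mulVec (faceCoboundary Δ φ) = 0 := by
  funext t
  rw [Pi.zero_apply, ← CharTwo.two_nsmul (∑ x ∈ t.1, faceValue Δ φ x),
    ← sum_edges_sum_vertices t.2]
  exact incidence_mulVec (fun e => ∑ x ∈ e, faceValue Δ φ x)
    (fun _ => sum_faceValue_of_mem_boundaryEdges) t

theorem faceValue_eq_of_mem_triangle (hφ : faceCoboundary Δ φ = 0) (ht : t ∈ triangles Δ)
    (hx : x ∈ t) (hy : y ∈ t) : faceValue Δ φ x = faceValue Δ φ y := by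
  classical
  obtain rfl | hxy := eq_or_ne x y
  · rfl
  have hsub : {x, y} ⊆ t := Finset.insert_subset hx (Finset.singleton_subset_iff.2 hy)
  have hsum : ∑ z ∈ {x, y}, faceValue Δ φ z = 0 := by
    obtain h | h := mem_boundaryEdges_or_mem_innerEdges
      (mem_edges_of_subset ht hsub (Finset.card_pair hxy)) ht hsub
    · exact sum_faceValue_of_mem_boundaryEdges h
    · exact congrFun hφ ⟨_, h⟩
  rwa [Finset.sum_pair hxy, CharTwo.add_eq_zero] at hsum

theorem faceValue_vertex_eq_zero (hΔ : IsTriangulationOf Δ Ω) (hφ : faceCoboundary Δ φ = 0)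
    (hv : v ∈ Δ.vertices) : faceValue Δ φ v = 0 := by
  obtain ⟨v₀, hv₀, hunbounded⟩ := exists_vertex_faceAt_notMem_dualBoundedFaces hΔ
  obtain ⟨t₀, ht₀, hvt₀⟩ := exists_triangle_of_mem_vertices hΔ hv₀
  obtain ⟨t, ht, hvt⟩ := exists_triangle_of_mem_vertices hΔ hv
  refine forall_of_forall_adj_imp (dualGraph_preconnected hΔ)
    (P := fun s => ∀ x ∈ s.1, faceValue Δ φ x = 0) ?_ (u := ⟨t₀, ht₀⟩) ?_ ⟨t, ht⟩ v hvt
  · rintro s s' ⟨-, e, he, hes, hes'⟩ hs y hy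
    obtain ⟨x, hx⟩ := SimplicialComplex.nonempty_of_mem_faces he.1
    rw [faceValue_eq_of_mem_triangle hφ s'.2 hy (hes' hx), hs x (hes hx)]
  · exact fun x hx => (faceValue_eq_of_mem_triangle hφ ht₀ hx hvt₀).trans
      (faceValue_eq_zero hunbounded)

theorem faceCoboundary_injective (hΔ : IsTriangulationOf Δ Ω) :
    Function.Injective (faceCoboundary Δ) := by
  refine (injective_iff_map_eq_zero _).2 fun φ hφ => funext fun F => ?_
  obtain ⟨p, hp, hF⟩ := F.2.2
  obtain ⟨v, hv, hpv⟩ := exists_vertex_faceAt_eq hΔ hp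
  exact (faceValue_of_faceAt_eq (hpv.symm.trans hF.symm)).symm.trans
    (faceValue_vertex_eq_zero hΔ hφ hv)

theorem eq_of_incidence_transpose_mulVec_eq_zero [Fintype (triangles Δ)]
    {g : triangles Δ → ZMod 2} (hg : (incidence Δ).transpose.mulVec g = 0) {s t : triangles Δ}
    (hadj : (dualGraph Δ).Adj s t) : g s = g t := by
  classical
  obtain ⟨hst, e, he, hes, het⟩ := hadj
  have hst' : s.1 ≠ t.1 := fun h => hst (Subtype.ext h)
  have hfilter : Finset.univ.filter (fun u : triangles Δ => e ⊆ u.1) = {s, t} := by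
    ext u
    simp only [Finset.mem_filter, Finset.mem_univ, true_and, Finset.mem_insert,
      Finset.mem_singleton, edge_subset_iff he s.2 t.2 u.2 hst' hes het, Subtype.ext_iff]
  have hsum := congrFun hg ⟨e, he, s, s.2, t, t.2, hst', hes, het⟩
  simp only [Matrix.mulVec, dotProduct, Matrix.transpose_apply, incidence, Matrix.of_apply,
    ite_mul, one_mul, zero_mul, Pi.zero_apply] at hsum
  rwa [← Finset.sum_filter, hfilter, Finset.sum_pair hst, CharTwo.add_eq_zero] at hsum

theorem card_triangles_le_rank_incidence [Fintype (triangles Δ)] [Fintype (innerEdges Δ)]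
    (hΔ : IsTriangulationOf Δ Ω) : Fintype.card (triangles Δ) ≤ (incidence Δ).rank + 1 := by
  have := (nonempty_triangles hΔ).to_subtype
  let t₀ := Classical.arbitrary (triangles Δ)
  have hker : (incidence Δ).transpose.mulVecLin.ker ≤ Submodule.span (ZMod 2) {1} := fun g hg => by
    refine Submodule.mem_span_singleton.2 ⟨g t₀, funext fun t => ?_⟩
    rw [Pi.smul_apply, Pi.one_apply, smul_eq_mul, mul_one]
    exact forall_of_forall_adj_imp (dualGraph_preconnected hΔ) (P := fun s => g t₀ = g s)
      (fun s s' hadj h => h.trans (eq_of_incidence_transpose_mulVec_eq_zero hg hadj)) rfl t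
  have hnullity := (Submodule.finrank_mono hker).trans_eq (finrank_span_singleton one_ne_zero)
  have hrank := LinearMap.finrank_range_add_finrank_ker (incidence Δ).transpose.mulVecLin
  rw [Module.finrank_fintype_fun_eq_card] at hrank
  rw [← Matrix.rank_transpose, Matrix.rank]
  omega

theorem ncard_dualBoundedFaces_add_ncard_triangles_le (hΔ : IsTriangulationOf Δ Ω) :
    (dualBoundedFaces Δ).ncard + (triangles Δ).ncard ≤ (innerEdges Δ).ncard + 1 := by
  have := (finite_triangles hΔ.finite_faces).fintype
  have := (finite_innerEdges hΔ.finite_faces).fintype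
  have := (finite_dualBoundedFaces hΔ).fintype
  have hrank := card_triangles_le_rank_incidence hΔ
  have hnullity := LinearMap.finrank_range_add_finrank_ker (incidence Δ).mulVecLin
  have hker := LinearMap.finrank_le_finrank_of_injective
    (f := (faceCoboundary Δ).codRestrict (incidence Δ).mulVecLin.ker fun φ =>
      LinearMap.mem_ker.2 (incidence_mulVec_faceCoboundary φ))
    (fun φ ψ h => faceCoboundary_injective hΔ (congrArg Subtype.val h))
  rw [Module.finrank_fintype_fun_eq_card] at hnullity hker
  rw [Matrix.rank] at hrank
  simp only [← Nat.card_coe_set_eq, Nat.card_eq_fintype_card]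
  omega

theorem ncard_boundaryEdges_add_le (hΔ : IsTriangulationOf Δ Ω) :
    (boundaryEdges Δ).ncard + 3 * (dualBoundedFaces Δ).ncard ≤
      (dualGraph Δ).edgeSet.ncard + 3 := by
  have heuler := ncard_dualBoundedFaces_add_ncard_triangles_le hΔ
  have hcount := three_mul_ncard_triangles hΔ.finite_faces
  have hinner := ncard_innerEdges_le hΔ.finite_faces
  omega

end Euler

section Conclusion

variable {Δ : SimplicialComplex ℝ Plane} {Ω : Set Plane}

theorem nonempty_boundaryEdges (hΔ : IsTriangulationOf Δ Ω) : (boundaryEdges Δ).Nonempty := by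
  by_contra hempty
  rw [not_nonempty_iff_eq_empty] at hempty
  have hne : Δ.space.Nonempty := hΔ.space_eq ▸ hΔ.isConnected.nonempty.closure
  have huniv : univ ⊆ Δ.space :=
    subset_space_of_disjoint_boundaryEdges hΔ isPreconnected_univ (by simp [hempty]) (by simpa)
  exact (isCompact_space hΔ.finite_faces).ne_univ (univ_subset_iff.1 huniv)

theorem space_subset_of_boundaryEdges_subset (hΔ : IsTriangulationOf Δ Ω) {C : Set Plane}
    (hconvex : Convex ℝ C) (hclosed : IsClosed C)
    (hb : ∀ e ∈ boundaryEdges Δ, convexHull ℝ (e : Set Plane) ⊆ C) : Δ.space ⊆ C := by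
  intro p hp
  by_contra hpC
  obtain ⟨f, u, hfC, hfp⟩ := geometric_hahn_banach_closed_point hconvex hclosed hpC
  have hf : f ≠ 0 := by
    rintro rfl
    obtain ⟨e, he⟩ := nonempty_boundaryEdges hΔ
    obtain ⟨q, hq⟩ := SimplicialComplex.nonempty_of_mem_faces he.1.1
    exact (hfC q (hb e he (subset_convexHull ℝ _ hq))).not_gt hfp
  have hhalf : Convex ℝ {x | u < f x} := convex_halfSpace_gt f.toLinearMap.isLinear u
  have hdisj : Disjoint {x | u < f x} (⋃ e ∈ boundaryEdges Δ, convexHull ℝ (e : Set Plane)) :=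
    disjoint_left.2 fun x hx hxb => (hfC x (iUnion₂_subset hb hxb)).not_gt hx
  exact not_isBounded_halfSpace hf u ((isCompact_space hΔ.finite_faces).isBounded.subset
    (subset_space_of_disjoint_boundaryEdges hΔ hhalf.isPreconnected hdisj ⟨p, hfp, hp⟩))

theorem space_eq_convexHull_of_boundaryEdges_subset (hΔ : IsTriangulationOf Δ Ω)
    {s : Finset Plane} (hs : AffineIndependent ℝ ((↑) : s → Plane)) (hcard : s.card = 3)
    (hb : ∀ e ∈ boundaryEdges Δ, e ⊆ s) : Δ.space = convexHull ℝ (s : Set Plane) := by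
  have hconvex := convex_convexHull ℝ (s : Set Plane)
  have hclosed : IsClosed (convexHull ℝ (s : Set Plane)) := (isCompact_convexHull_finset s).isClosed
  have hsub : Δ.space ⊆ convexHull ℝ (s : Set Plane) :=
    space_subset_of_boundaryEdges_subset hΔ hconvex hclosed fun e he =>
      convexHull_mono (Finset.coe_subset.2 (hb e he))
  have hinterior : interior (convexHull ℝ (s : Set Plane)) = openSimplex ℝ s :=
    interior_convexHull_eq_openSimplex hs (by rw [hcard, finrank_plane])
  have hdisj : Disjoint (interior (convexHull ℝ (s : Set Plane)))
      (⋃ e ∈ boundaryEdges Δ, convexHull ℝ (e : Set Plane)) := by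
    rw [hinterior, disjoint_iUnion₂_right]
    refine fun e he => disjoint_openSimplex_convexHull hs ((hb e he).ssubset_of_ne ?_)
    rintro rfl
    exact absurd (he.1.2.symm.trans hcard) (by norm_num)
  obtain ⟨t, ht⟩ := nonempty_triangles hΔ
  have hbary := openSimplex_triangle_subset_interior_space ht
    (barycenter_mem_openSimplex (SimplicialComplex.nonempty_of_mem_faces ht.1))
  have hbary' := interior_mono hsub hbary
  refine hsub.antisymm ?_
  rw [← hclosed.closure_eq, ← hconvex.closure_interior_eq_closure_of_nonempty_interior ⟨_, hbary'⟩]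
  exact closure_minimal (subset_space_of_disjoint_boundaryEdges hΔ hconvex.interior.isPreconnected
    hdisj ⟨_, hbary', interior_subset hbary⟩) (isCompact_space hΔ.finite_faces).isClosed

theorem exists_boundary_triangle [DecidableEq Plane] (hΔ : IsTriangulationOf Δ Ω)
    (hG : DualContractible Δ) : ∃ a b c : Plane, a ≠ b ∧ b ≠ c ∧ c ≠ a ∧
      ∀ e, e ∈ boundaryEdges Δ ↔ e = {a, b} ∨ e = {b, c} ∨ e = {c, a} := by
  have hfin := finite_boundaryEdges hΔ.finite_faces
  have hcard : hfin.toFinset.card ≤ 3 := by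
    have := ncard_boundaryEdges_add_le hΔ
    rw [← ncard_eq_toFinset_card _ hfin]
    unfold DualContractible at hG
    omega
  obtain ⟨a, b, c, hab, hbc, hca, h⟩ := exists_triangle_of_even_degrees
    (fun e he => (hfin.mem_toFinset.1 he).1.2) (even_card_boundaryEdges_filter hΔ.finite_faces)
    (hfin.toFinset_nonempty.2 (nonempty_boundaryEdges hΔ)) hcard
  refine ⟨a, b, c, hab, hbc, hca, fun e => ?_⟩
  rw [← hfin.mem_toFinset, h, Finset.mem_insert, Finset.mem_insert, Finset.mem_singleton]

theorem not_wbtw_of_edge [DecidableEq Plane] {x y z : Plane} (hy : y ∈ Δ.vertices)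
    (hxz : {x, z} ∈ edges Δ) (hyx : y ≠ x) (hyz : y ≠ z) : ¬Wbtw ℝ x y z := fun h => by
  have hhull : y ∈ convexHull ℝ (({x, z} : Finset Plane) : Set Plane) := by
    rwa [Finset.coe_pair, convexHull_pair, mem_segment_iff_wbtw]
  have := (SimplicialComplex.vertex_mem_convexHull_iff hy hxz.1).1 hhull
  simp [hyx, hyz] at this

theorem affineIndependent_of_edges [DecidableEq Plane] {a b c : Plane} (hne_ab : a ≠ b)
    (hne_bc : b ≠ c) (hne_ca : c ≠ a) (hab : {a, b} ∈ edges Δ) (hbc : {b, c} ∈ edges Δ)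
    (hca : {c, a} ∈ edges Δ) : AffineIndependent ℝ ![a, b, c] := by
  have ha : a ∈ Δ.vertices := mem_vertices_of_mem hab.1 (Finset.mem_insert_self _ _)
  have hb : b ∈ Δ.vertices := mem_vertices_of_mem hbc.1 (Finset.mem_insert_self _ _)
  have hc : c ∈ Δ.vertices := mem_vertices_of_mem hca.1 (Finset.mem_insert_self _ _)
  rw [affineIndependent_iff_not_collinear_set]
  intro hcol
  obtain h | h | h := hcol.wbtw_or_wbtw_or_wbtw
  · exact not_wbtw_of_edge hb hca hne_bc hne_ab.symm h.symm
  · exact not_wbtw_of_edge hc hab hne_ca hne_bc.symm h.symm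
  · exact not_wbtw_of_edge ha hbc hne_ab hne_ca.symm h.symm

theorem space_eq_triangle [DecidableEq Plane] (hΔ : IsTriangulationOf Δ Ω) {a b c : Plane}
    (habc : AffineIndependent ℝ ![a, b, c])
    (hb : ∀ e ∈ boundaryEdges Δ, e = {a, b} ∨ e = {b, c} ∨ e = {c, a}) :
    Δ.space = convexHull ℝ {a, b, c} := by
  have hrange : range ![a, b, c] = (({a, b, c} : Finset Plane) : Set Plane) := by
    simp only [Matrix.range_cons, Matrix.range_empty, union_empty, singleton_union,
      Finset.coe_insert, Finset.coe_singleton]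
  have hcard : ({a, b, c} : Finset Plane).card = 3 := by
    rw [← ncard_coe_finset, ← hrange, ncard_range_of_injective habc.injective, Nat.card_fin]
  have hind := habc.range
  rw [hrange] at hind
  rw [space_eq_convexHull_of_boundaryEdges_subset hΔ hind hcard fun e he => ?_]
  · simp only [Finset.coe_insert, Finset.coe_singleton]
  · obtain rfl | rfl | rfl := hb e he <;> simp [Finset.insert_subset_iff]

end Conclusion

end PlanarTriangulation

theorem mainTheorem10
    (Δ : Geometry.SimplicialComplex ℝ PlanarTriangulation.Plane)
    (Ω : Set PlanarTriangulation.Plane)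
    (hΔ : PlanarTriangulation.IsTriangulationOf Δ Ω)
    (hG : PlanarTriangulation.DualContractible Δ) :
    PlanarTriangulation.IsSubdividedTriangle Δ := by
  classical
  obtain ⟨a, b, c, hab, hbc, hca, hboundary⟩ :=
    PlanarTriangulation.exists_boundary_triangle hΔ hG
  have habc : AffineIndependent ℝ ![a, b, c] :=
    PlanarTriangulation.affineIndependent_of_edges hab hbc hca ((hboundary _).2 (Or.inl rfl)).1
      ((hboundary _).2 (Or.inr (Or.inl rfl))).1 ((hboundary _).2 (Or.inr (Or.inr rfl))).1
  refine ⟨a, b, c, habc, fun e => ?_,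
    PlanarTriangulation.space_eq_triangle hΔ habc fun e => (hboundary e).1⟩
  rw [hboundary]
  simp only [← Finset.coe_pair, Finset.coe_inj]
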